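/- Setting. Let $\mathcal C\subset\mathbb R^d$ be a measurable set of positive volume contained in a ball of radius $R>0$, and let $H>0$, $L\ge 0$, $\beta\in\mathbb R$, and let $m,s\ge 1$, $T\ge 2s$ be integers. In each round $t=1,\dots,T$ a learner draws $\rho_t\in\mathcal C$, and then a utility $u_t:\mathcal C\to[0,H]$, measurable and piecewise $L$-Lipschitz (with finitely many pieces), is revealed. The utilities may be random, and $u_t$ may depend on the past of the game, but not on the draw of $\rho_t$. The learner runs the Generalized Share Exponential Forecaster with parameters $\lambda,\alpha,\gamma$: $w_1\equiv 1$, and in round $t$ it draws $\rho_t$ from the density $p_t=w_t/W_t$ on $\mathcal C$, where $W_t=\int_{\mathcal C}w_t$, and sets $$w_{t+1}(\rho)=(1-\alpha)e^{\lambda u_t(\rho)}w_t(\rho)+\alpha\Big(\int_{\mathcal C}e^{\lambda u_t(x)}w_t(x)\,dx\Big)\sum_{i=1}^t\beta_{i,t}\,p_i(\rho),\qquad \beta_{i,t}=\frac{e^{-\gamma(t-i)}}{\sum_{j=1}^te^{-\gamma(t-j)}} .$$ For $D\subseteq\mathcal C$ let $\mathrm{OPT}(D)=\sup\sum_{i=1}^s\sum_{t=t_{i-1}}^{t_i-1}u_t(\rho_i^*)$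 over all $1=t_0<t_1<\dots<t_s=T+1$ and all $\rho_1^*,\dots,\rho_s^*\in D$ with at most $m$ distinct values. The ($m$-sparse, $s$-shifted) regret is $\mathbb E\big[\mathrm{OPT}(\mathcal C)-\sum_{t=1}^Tu_t(\rho_t)\big]$. Assume that the utilities are $\beta$-dispersed with constant $K$: for every $\epsilon\ge T^{-\beta}$, $$\mathbb E\Big[\sup_{\rho\in\mathcal C}\big|\{t\le T: u_t\text{ is not }L\text{-Lipschitz on }\mathcal B(\rho,\epsilon)\cap\mathcal C\}\big|\Big]\le K\epsilon T .$$ Assume also, for a constant $\kappa>0$, that almost surely $\mathrm{OPT}(D)=\mathrm{OPT}(\mathcal C)$ for the set $D$ of those $\rho\in\mathcal C$ with $\mathrm{Vol}(\mathcal C\cap\mathcal B(\rho,T^{-\beta}))\ge\min(1,\kappa T^{-\beta}/R)^d\,\mathrm{Vol}(\mathcal C)$. (If $\mathcal C$ is convex, then $D=\mathcal C$ for $\kappa=1/2$; every $\rho$ with $\mathcal B(\rho,T^{-\beta})\subset\mathcal C$ belongs to $D$ for $\kappa=1$.) Theorem. Let $\alpha=s/T$, $\gamma=s/(mT)$, and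 let either $\lambda=\frac1H\sqrt{\big(md\log(RT^\beta)+s\log(mT/s)\big)/T}$, or $\lambda=\frac1H\sqrt{\big(md\log(RT^\beta)+s\log(T/s)\big)/T}$ with $s\log m\le B\big(md\log(RT^\beta)+s\log(T/s)\big)$ for a constant $B$ (for instance if $m\le(T/s)^B$ and $RT^\beta\ge1$). Here the square root of a negative number is read as $0$. Then the ($m$-sparse, $s$-shifted) regret is at most $$A\Big(H\sqrt{T\big(md\log(RT^\beta)+s\log(mT/s)\big)}+(mH+L)T^{1-\beta}\Big),$$ where $A$ depends only on $\kappa$, $K$ and $B$. -/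

import Mathlib

open MeasureTheory Metric Set
open scoped NNReal

noncomputable section

namespace GenShare

/-! Rounds are numbered `0, 1, …, T - 1`; the domain of experts is a set `C` in
`EuclideanSpace ℝ (Fin d)`, and a utility is a total function of which only the values on `C`
matter. -/

/-- `f` is piecewise `L`-Lipschitz on `C`: `C` is covered by finitely many pieces, on each of which
`f` is `L`-Lipschitz. -/
def PiecewiseLipschitzOn {d : ℕ} (L : ℝ≥0) (f : EuclideanSpace ℝ (Fin d) → ℝ)
    (C : Set (EuclideanSpace ℝ (Fin d))) : Prop :=
  ∃ S : Set (Set (EuclideanSpace ℝ (Fin d))), S.Finite ∧ C ⊆ ⋃₀ S ∧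
    ∀ A ∈ S, LipschitzOnWith L f (A ∩ C)

/-- The weights of the Generalized Share Exponential Forecaster with step size `lam`, exploration
parameter `α` and discount rate `γ`, run on the utilities `u 0, u 1, …`. The factor
`weight i ρ / ∫ weight i` is the sampling density of round `i`. -/
def weight {d : ℕ} (C : Set (EuclideanSpace ℝ (Fin d))) (lam α γ : ℝ)
    (u : ℕ → EuclideanSpace ℝ (Fin d) → ℝ) : ℕ → EuclideanSpace ℝ (Fin d) → ℝ
  | 0, _ => 1
  | t + 1, ρ =>
      (1 - α) * (Real.exp (lam * u t ρ) * weight C lam α γ u t ρ)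
      + α * (∫ x in C, Real.exp (lam * u t x) * weight C lam α γ u t x)
        * ∑ i : Fin (t + 1),
            Real.exp (-γ * ((t : ℝ) - (i : ℕ)))
              / (∑ j : Fin (t + 1), Real.exp (-γ * ((t : ℝ) - (j : ℕ))))
              * (weight C lam α γ u i ρ / ∫ x in C, weight C lam α γ u i x)
  termination_by t => t
  decreasing_by all_goals omega

/-- The density (on `C`) from which the forecaster samples its action in round `t`. -/
def samplingDensity {d : ℕ} (C : Set (EuclideanSpace ℝ (Fin d))) (lam α γ : ℝ)
    (u : ℕ → EuclideanSpace ℝ (Fin d) → ℝ) (t : ℕ) (ρ : EuclideanSpace ℝ (Fin d)) : ℝ :=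
  weight C lam α γ u t ρ / ∫ x in C, weight C lam α γ u t x

/-- `U` (utilities, possibly random and adaptive) and `X` (actions) form a play of `T` rounds in
which the learner runs the Generalized Share Exponential Forecaster. Here `𝓕 t` is the information
available just before the action of round `t` is drawn, the utility of round `t` included: given
`𝓕 t`, the action `X t` is drawn from `samplingDensity` at round `t`, which only involves the
utilities of the earlier rounds. -/
structure IsPlay {d : ℕ} {Ω : Type*} [mΩ : MeasurableSpace Ω] (P : Measure Ω)
    (𝓕 : Filtration ℕ mΩ) (C : Set (EuclideanSpace ℝ (Fin d))) (lam α γ : ℝ) (T : ℕ)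
    (U : ℕ → Ω → EuclideanSpace ℝ (Fin d) → ℝ) (X : ℕ → Ω → EuclideanSpace ℝ (Fin d)) :
    Prop where
  utility_measurable : ∀ t < T,
    @Measurable (Ω × EuclideanSpace ℝ (Fin d)) ℝ ((𝓕 t).prod inferInstance) inferInstance
      (fun z => U t z.1 z.2)
  action_measurable : ∀ t < T, Measurable[𝓕 (t + 1)] (X t)
  action_law : ∀ t < T, ∀ B : Set Ω, MeasurableSet[𝓕 t] B →
    ∀ A : Set (EuclideanSpace ℝ (Fin d)), MeasurableSet A →
      P (B ∩ X t ⁻¹' A) =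
        ∫⁻ ω in B, ∫⁻ ρ in A ∩ C,
          ENNReal.ofReal (samplingDensity C lam α γ (fun i => U i ω) t ρ) ∂volume ∂P

/-- The payoffs of the offline strategies which split the `T` rounds into `s` consecutive nonempty
phases, play one fixed expert of `D` in each phase, and use at most `m` distinct experts. -/
def offlinePayoffs {d : ℕ} (D : Set (EuclideanSpace ℝ (Fin d))) (m s T : ℕ)
    (u : ℕ → EuclideanSpace ℝ (Fin d) → ℝ) : Set ℝ :=
  {v | ∃ (τ : Fin (s + 1) → ℕ) (ρ : Fin s → EuclideanSpace ℝ (Fin d)),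
    StrictMono τ ∧ τ 0 = 0 ∧ τ (Fin.last s) = T ∧ (∀ i, ρ i ∈ D) ∧ (range ρ).ncard ≤ m ∧
    v = ∑ i : Fin s, ∑ t ∈ Finset.Ico (τ i.castSucc) (τ i.succ), u t (ρ i)}

/-- The optimal payoff of an offline strategy with experts in `D`. -/
def offlineOpt {d : ℕ} (D : Set (EuclideanSpace ℝ (Fin d))) (m s T : ℕ)
    (u : ℕ → EuclideanSpace ℝ (Fin d) → ℝ) : ℝ :=
  sSup (offlinePayoffs D m s T u)

/-- The realized (`m`-sparse, `s`-shifted) regret of the actions `x 0, …, x (T - 1)`. -/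
def sparseShiftedRegret {d : ℕ} (C : Set (EuclideanSpace ℝ (Fin d))) (m s T : ℕ)
    (u : ℕ → EuclideanSpace ℝ (Fin d) → ℝ) (x : ℕ → EuclideanSpace ℝ (Fin d)) : ℝ :=
  offlineOpt C m s T u - ∑ t ∈ Finset.range T, u t (x t)

/-- The largest number, over centres `ρ ∈ C`, of the utilities `u 0, …, u (T - 1)` which are not
`L`-Lipschitz in the ball of radius `ε` about `ρ` (in the metric space `C`). -/
def nonLipschitzCount {d : ℕ} (C : Set (EuclideanSpace ℝ (Fin d))) (L : ℝ≥0) (T : ℕ)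
    (u : ℕ → EuclideanSpace ℝ (Fin d) → ℝ) (ε : ℝ) : ℝ :=
  ⨆ ρ : C, ((({t : ℕ | t < T ∧ ¬ LipschitzOnWith L (u t) (ball (ρ : EuclideanSpace ℝ (Fin d)) ε ∩ C)}
    : Set ℕ).ncard : ℕ) : ℝ)

/-- The expectation of `Z` is at most `b`. Suprema over uncountably many experts need not be
measurable, so this is the upper expectation: `Z` has an integrable majorant of mean at most `b`.
For integrable `Z` it says exactly `E[Z] ≤ b`. -/
def ExpectationLE {Ω : Type*} [MeasurableSpace Ω] (P : Measure Ω) (Z : Ω → ℝ) (b : ℝ) : Prop :=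
  ∃ Y : Ω → ℝ, Integrable Y P ∧ (∀ᵐ ω ∂P, Z ω ≤ Y ω) ∧ ∫ ω, Y ω ∂P ≤ b

/-- The random utilities `U 0, …, U (T - 1)` are `β`-dispersed with constant `K` over the
horizon `T`. Deterministic utilities are the case of `U` not depending on `ω`. -/
def IsDispersed {d : ℕ} {Ω : Type*} [MeasurableSpace Ω] (P : Measure Ω)
    (C : Set (EuclideanSpace ℝ (Fin d))) (L : ℝ≥0) (β K : ℝ) (T : ℕ)
    (U : ℕ → Ω → EuclideanSpace ℝ (Fin d) → ℝ) : Prop :=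
  ∀ ε : ℝ, (T : ℝ) ^ (-β) ≤ ε →
    ExpectationLE P (fun ω => nonLipschitzCount C L T (fun t => U t ω) ε) (K * (ε * T))

/-- The points `ρ` of `C` around which `C` is not too thin at scale `r`: the ball of radius `r`
about `ρ` contains a fraction at least `min 1 (κ r / R) ^ d` of the volume of `C`. If `C` lies in a ball
of radius `R`, this holds with `κ = 1` when the ball of radius `r` about `ρ` is contained in `C`,
and with `κ = 1 / 2` at every point of `C` when `C` is convex. -/
def thickPoints {d : ℕ} (C : Set (EuclideanSpace ℝ (Fin d))) (κ R r : ℝ) :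
    Set (EuclideanSpace ℝ (Fin d)) :=
  {ρ | ρ ∈ C ∧ (min 1 (κ * r / R)) ^ d * volume.real C ≤ volume.real (C ∩ ball ρ r)}

end GenShare

end

/-!
The argument follows the total weight `W t` of the forecaster. Sharing does not change the total
weight, so `W (t + 1) / W t` is the mean of `exp (λ u_t)` under the sampling density `p_t`, and its
logarithm is at most `λ E_{p_t}[u_t] + (λ H) ^ 2` (`IsRun.log_growth_le`, for `λ H ≤ 1`).

In the other direction, fix an offline strategy and one of its at most `m` experts `v`. For every
point `x`, the densities `p_t x` grow by the factor `(1 - α) exp (λ u_t x) / (W (t + 1) / W t)` in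
the rounds in which `v` is played (`IsRun.log_density_step`). While another expert is played nothing
is tracked; at the return to `v`, the share of the density from the round in which `v` was left
guarantees a fraction `α γ / 2` of it, discounted by `exp (-γ)` to the length of the absence
(`IsRun.log_density_return`). Over the whole game `v` pays at most `exp (-γ T)` for its absences, and
all experts together return at most `s` times. Integrating the resulting lower bound over
`C ∩ ball v r` and using that `p_t` has total mass `1` gives one inequality per expert
(`IsRun.log_mass_le`). Their sum over the experts (`IsRun.strategy_le`) bounds the payoff of the
strategy by `∑ E_{p_t}[u_t]`, with four kinds of loss: the logarithms of the volume ratios,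
`m d log (R / r)` up to a constant; the price of tracking, `s log (m T / s)` up to a constant; and
the losses `L r T` and `m H N` from replacing `v` by a nearby point, where `N` is the number of
non-Lipschitz utilities at scale `r = T ^ (-β)`, whose mean dispersion bounds by `K r T`.
The prescribed step sizes balance `λ H ^ 2 T` against the first two losses over `λ`
(`step_size_tradeoff`).

Given the past, the action of round `t` has density `p_t`, so the expectations of `u_t(ρ_t)` and of
`E_{p_t}[u_t]` agree (`integral_utility_of_isPlay`); this identifies two measures on the product of
the space of histories with the domain.

Two regimes are outside this argument. If `R` is at most a constant multiple of `r`, the logarithm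
`log (R / r)` does not control the volume ratios and may be negative; but then all of `C` fits into
one ball of a comparable scale, and dispersion at that scale bounds the regret of any sequence of
actions (`IsRun.offlineOpt_le_of_diam`). If `λ H > 1`, the claimed bound is at least `H T`.
-/

/-! ### The weights and the sampling densities -/

section Weights

variable {d : ℕ} {C : Set (EuclideanSpace ℝ (Fin d))} {lam α γ H : ℝ} {T : ℕ}
  {u : ℕ → EuclideanSpace ℝ (Fin d) → ℝ}

/-- The total weight of the forecaster at the beginning of round `t`. -/
noncomputable def totalWeight (C : Set (EuclideanSpace ℝ (Fin d))) (lam α γ : ℝ)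
    (u : ℕ → EuclideanSpace ℝ (Fin d) → ℝ) (t : ℕ) : ℝ :=
  ∫ x in C, GenShare.weight C lam α γ u t x

/-- The discount `β_{i,t}` with which the density of round `i` enters the mixture that is shared
at the end of round `t`. -/
noncomputable def shareCoeff (γ : ℝ) (t i : ℕ) : ℝ :=
  Real.exp (-γ * ((t : ℝ) - i)) / ∑ j : Fin (t + 1), Real.exp (-γ * ((t : ℝ) - (j : ℕ)))

lemma weight_zero (x : EuclideanSpace ℝ (Fin d)) : GenShare.weight C lam α γ u 0 x = 1 := by
  rw [GenShare.weight]

lemma weight_succ (t : ℕ) (x : EuclideanSpace ℝ (Fin d)) :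
    GenShare.weight C lam α γ u (t + 1) x =
      (1 - α) * (Real.exp (lam * u t x) * GenShare.weight C lam α γ u t x)
      + α * (∫ y in C, Real.exp (lam * u t y) * GenShare.weight C lam α γ u t y)
        * ∑ i : Fin (t + 1), shareCoeff γ t i * GenShare.samplingDensity C lam α γ u i x := by
  rw [GenShare.weight]
  rfl

lemma samplingDensity_eq (t : ℕ) (x : EuclideanSpace ℝ (Fin d)) :
    GenShare.samplingDensity C lam α γ u t x =
      GenShare.weight C lam α γ u t x / totalWeight C lam α γ u t := rfl

lemma sum_shareCoeff (γ : ℝ) (t : ℕ) : ∑ i : Fin (t + 1), shareCoeff γ t i = 1 := by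
  unfold shareCoeff
  rw [← Finset.sum_div]
  exact div_self (Finset.sum_pos (fun _ _ => Real.exp_pos _) Finset.univ_nonempty).ne'

lemma shareCoeff_pos (γ : ℝ) (t i : ℕ) : 0 < shareCoeff γ t i :=
  div_pos (Real.exp_pos _) (Finset.sum_pos (fun _ _ => Real.exp_pos _) Finset.univ_nonempty)

/-- The normalizing sum is at most the full geometric series `1 / (1 - exp (-γ)) ≤ 2 / γ`. -/
lemma half_mul_exp_le_shareCoeff (hγ : 0 < γ) (hγ1 : γ ≤ 1) (t i : ℕ) :
    γ / 2 * Real.exp (-γ * ((t : ℝ) - i)) ≤ shareCoeff γ t i := by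
  have hS : 0 < ∑ j : Fin (t + 1), Real.exp (-γ * ((t : ℝ) - (j : ℕ))) :=
    Finset.sum_pos (fun _ _ => Real.exp_pos _) Finset.univ_nonempty
  have hq1 : Real.exp (-γ) ≤ 1 - γ / 2 := by
    rw [Real.exp_neg, inv_le_comm₀ (Real.exp_pos _) (by linarith)]
    refine le_trans ?_ (Real.add_one_le_exp γ)
    rw [inv_le_comm₀ (by linarith) (by linarith), inv_eq_one_div, div_le_iff₀ (by linarith)]
    nlinarith
  have hsum : ∑ j : Fin (t + 1), Real.exp (-γ * ((t : ℝ) - (j : ℕ))) ≤ 2 / γ := by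
    rw [Fin.sum_univ_eq_sum_range (fun j => Real.exp (-γ * ((t : ℝ) - (j : ℕ)))) (t + 1),
      ← Finset.sum_range_reflect]
    have hgeom : ∀ j ∈ Finset.range (t + 1),
        Real.exp (-γ * ((t : ℝ) - ((t + 1 - 1 - j : ℕ) : ℝ))) = Real.exp (-γ) ^ j := by
      intro j hj
      have hj' : j ≤ t := Nat.lt_succ_iff.mp (Finset.mem_range.mp hj)
      rw [← Real.exp_nat_mul, Nat.add_sub_cancel, Nat.cast_sub hj']
      congr 1
      ring
    rw [Finset.sum_congr rfl hgeom, geom_sum_eq (by linarith), le_div_iff₀ hγ]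
    have h1 : 0 < 1 - Real.exp (-γ) := by linarith
    have h2 : (Real.exp (-γ) ^ (t + 1) - 1) / (Real.exp (-γ) - 1)
        = (1 - Real.exp (-γ) ^ (t + 1)) / (1 - Real.exp (-γ)) := by
      rw [← neg_div_neg_eq]
      congr 1 <;> ring
    rw [h2, div_mul_eq_mul_div, div_le_iff₀ h1]
    have h3 : 0 < Real.exp (-γ) ^ (t + 1) := by positivity
    nlinarith
  unfold shareCoeff
  rw [le_div_iff₀ hS]
  have he := Real.exp_pos (-γ * ((t : ℝ) - i))
  calc γ / 2 * Real.exp (-γ * ((t : ℝ) - i)) * _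
      ≤ γ / 2 * Real.exp (-γ * ((t : ℝ) - i)) * (2 / γ) := by gcongr
    _ = Real.exp (-γ * ((t : ℝ) - i)) := by field_simp

/-- The weights are jointly measurable in the utilities' randomness and in the expert. -/
lemma measurable_weight {Ω : Type*} [MeasurableSpace Ω]
    {U : ℕ → Ω → EuclideanSpace ℝ (Fin d) → ℝ} (t : ℕ)
    (hU : ∀ i < t, Measurable fun z : Ω × EuclideanSpace ℝ (Fin d) => U i z.1 z.2) :
    Measurable fun z : Ω × EuclideanSpace ℝ (Fin d) =>
      GenShare.weight C lam α γ (fun i => U i z.1) t z.2 := by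
  induction t using Nat.strong_induction_on with
  | _ t ih =>
    cases t with
    | zero => simp only [weight_zero]; exact measurable_const
    | succ t =>
      have hint : ∀ f : Ω × EuclideanSpace ℝ (Fin d) → ℝ, Measurable f →
          Measurable fun z : Ω × EuclideanSpace ℝ (Fin d) => ∫ y in C, f (z.1, y) :=
        fun f hf => (hf.stronglyMeasurable.integral_prod_right'
          (ν := volume.restrict C)).measurable.comp measurable_fst
      have hw : ∀ i ≤ t, Measurable fun z : Ω × EuclideanSpace ℝ (Fin d) =>
          GenShare.weight C lam α γ (fun i => U i z.1) i z.2 :=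
        fun i hi => ih i (Nat.lt_succ_of_le hi) fun j hj => hU j (by omega)
      have he : Measurable fun z : Ω × EuclideanSpace ℝ (Fin d) =>
          Real.exp (lam * U t z.1 z.2) * GenShare.weight C lam α γ (fun i => U i z.1) t z.2 :=
        ((hU t (Nat.lt_succ_self t)).const_mul lam).exp.mul (hw t le_rfl)
      simp only [weight_succ]
      refine (he.const_mul (1 - α)).add (((hint _ he).const_mul α).mul ?_)
      refine Finset.measurable_sum _ fun i _ => ?_
      have hi := hw i (Nat.lt_succ_iff.mp i.2)
      exact (hi.div (hint _ hi)).const_mul _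

/-- The standing assumptions on a realized run of the forecaster for `T` rounds. -/
structure IsRun (C : Set (EuclideanSpace ℝ (Fin d))) (α H : ℝ) (T : ℕ)
    (u : ℕ → EuclideanSpace ℝ (Fin d) → ℝ) : Prop where
  measurableSet : MeasurableSet C
  volume_ne_top : volume C ≠ ⊤
  volume_pos : 0 < volume C
  measurable : ∀ t < T, Measurable (u t)
  mem_Icc : ∀ t < T, ∀ x ∈ C, u t x ∈ Icc 0 H
  rate_pos : 0 < α
  rate_lt_one : α < 1

lemma IsRun.measurable_weight (h : IsRun C α H T u) {t : ℕ} (ht : t ≤ T) :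
    Measurable (GenShare.weight C lam α γ u t) := by
  have := _root_.measurable_weight (Ω := Unit) (C := C) (lam := lam) (α := α) (γ := γ)
    (U := fun i _ => u i) t (fun i hi => (h.measurable i (by omega)).comp measurable_snd)
  exact this.comp (measurable_const (a := ()) |>.prodMk measurable_id)

lemma IsRun.integrableOn (h : IsRun C α H T u) {f : EuclideanSpace ℝ (Fin d) → ℝ}
    (hf : Measurable f) {a b : ℝ} (hab : ∀ x ∈ C, f x ∈ Icc a b) : IntegrableOn f C :=
  Measure.integrableOn_of_bounded (M := max |a| |b|) h.volume_ne_top hf.aestronglyMeasurable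
    ((ae_restrict_iff' h.measurableSet).mpr <| Filter.Eventually.of_forall fun x hx =>
      abs_le_max_abs_abs (hab x hx).1 (hab x hx).2)

lemma IsRun.setIntegral_pos (h : IsRun C α H T u) {f : EuclideanSpace ℝ (Fin d) → ℝ}
    (hf : IntegrableOn f C) (h0 : ∀ x, 0 < f x) : 0 < ∫ x in C, f x := by
  rw [setIntegral_pos_iff_support_of_nonneg_ae
    (Filter.Eventually.of_forall fun x => (h0 x).le) hf]
  rw [Function.support_eq_univ (fun x => (h0 x).ne'), univ_inter]
  exact h.volume_pos

lemma IsRun.weight_pos_bdd (h : IsRun C α H T u) (hl : 0 ≤ lam) (t : ℕ) (ht : t ≤ T) :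
    (∀ x, 0 < GenShare.weight C lam α γ u t x) ∧
      ∃ b, ∀ x ∈ C, GenShare.weight C lam α γ u t x ≤ b := by
  induction t using Nat.strong_induction_on with
  | _ t ih =>
    cases t with
    | zero => exact ⟨fun x => by simp [weight_zero], 1, fun x _ => by simp [weight_zero]⟩
    | succ t =>
      have hI : ∀ i ≤ t, 0 < totalWeight C lam α γ u i := fun i hi => by
        obtain ⟨hp, b, hb⟩ := ih i (by omega) (by omega)
        exact h.setIntegral_pos (h.integrableOn (h.measurable_weight (by omega))
          (fun x hx => ⟨(hp x).le, hb x hx⟩)) hp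
      obtain ⟨hp, b, hb⟩ := ih t (by omega) (by omega)
      have hep : ∀ x, 0 < Real.exp (lam * u t x) * GenShare.weight C lam α γ u t x :=
        fun x => mul_pos (Real.exp_pos _) (hp x)
      have heb : ∀ x ∈ C, Real.exp (lam * u t x) * GenShare.weight C lam α γ u t x
          ≤ Real.exp (lam * H) * b := fun x hx =>
        mul_le_mul (Real.exp_le_exp.mpr (mul_le_mul_of_nonneg_left
          (h.mem_Icc t (by omega) x hx).2 hl)) (hb x hx) (hp x).le (Real.exp_pos _).le
      have hJ : 0 < ∫ x in C, Real.exp (lam * u t x) * GenShare.weight C lam α γ u t x :=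
        h.setIntegral_pos (h.integrableOn ((((h.measurable t (by omega)).const_mul lam).exp).mul
          (h.measurable_weight (by omega))) (fun x hx => ⟨(hep x).le, heb x hx⟩)) hep
      have hα := h.rate_pos
      have hα1 := sub_pos.mpr h.rate_lt_one
      refine ⟨fun x => ?_, ?_⟩
      · rw [weight_succ]
        refine add_pos (mul_pos hα1 (hep x)) (mul_pos (mul_pos hα hJ) ?_)
        refine Finset.sum_pos (fun i _ => mul_pos (shareCoeff_pos _ _ _) ?_) Finset.univ_nonempty
        exact div_pos ((ih i i.2 (by omega)).1 x) (hI i (by omega))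
      · choose! b' hb' using fun i (hi : i < t + 1) => (ih i hi (by omega)).2
        refine ⟨(1 - α) * (Real.exp (lam * H) * b) +
          α * (∫ x in C, Real.exp (lam * u t x) * GenShare.weight C lam α γ u t x) *
          ∑ i : Fin (t + 1), shareCoeff γ t i * (b' i / totalWeight C lam α γ u i),
          fun x hx => ?_⟩
        rw [weight_succ]
        refine add_le_add (mul_le_mul_of_nonneg_left (heb x hx) hα1.le)
          (mul_le_mul_of_nonneg_left ?_ (mul_pos hα hJ).le)
        refine Finset.sum_le_sum fun i _ => mul_le_mul_of_nonneg_left ?_ (shareCoeff_pos _ _ _).le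
        exact div_le_div_of_nonneg_right (hb' i i.2 x hx) (hI i (by omega)).le

lemma IsRun.weight_pos (h : IsRun C α H T u) (hl : 0 ≤ lam) {t : ℕ} (ht : t ≤ T)
    (x : EuclideanSpace ℝ (Fin d)) : 0 < GenShare.weight C lam α γ u t x :=
  (h.weight_pos_bdd hl t ht).1 x

lemma IsRun.integrableOn_weight (h : IsRun C α H T u) (hl : 0 ≤ lam) {t : ℕ} (ht : t ≤ T) :
    IntegrableOn (GenShare.weight C lam α γ u t) C := by
  obtain ⟨hp, b, hb⟩ := h.weight_pos_bdd (γ := γ) hl t ht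
  exact h.integrableOn (h.measurable_weight ht) fun x hx => ⟨(hp x).le, hb x hx⟩

lemma IsRun.totalWeight_pos (h : IsRun C α H T u) (hl : 0 ≤ lam) {t : ℕ} (ht : t ≤ T) :
    0 < totalWeight C lam α γ u t :=
  h.setIntegral_pos (h.integrableOn_weight hl ht) (h.weight_pos hl ht)

lemma IsRun.samplingDensity_pos (h : IsRun C α H T u) (hl : 0 ≤ lam) {t : ℕ} (ht : t ≤ T)
    (x : EuclideanSpace ℝ (Fin d)) : 0 < GenShare.samplingDensity C lam α γ u t x :=
  div_pos (h.weight_pos hl ht x) (h.totalWeight_pos hl ht)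

lemma IsRun.integrableOn_samplingDensity (h : IsRun C α H T u) (hl : 0 ≤ lam) {t : ℕ}
    (ht : t ≤ T) : IntegrableOn (GenShare.samplingDensity C lam α γ u t) C :=
  (h.integrableOn_weight hl ht).div_const _

lemma IsRun.integral_samplingDensity (h : IsRun C α H T u) (hl : 0 ≤ lam) {t : ℕ} (ht : t ≤ T) :
    ∫ x in C, GenShare.samplingDensity C lam α γ u t x = 1 := by
  simp only [samplingDensity_eq, integral_div]
  exact div_self (h.totalWeight_pos hl ht).ne'

lemma IsRun.integrableOn_comp_mul_samplingDensity (h : IsRun C α H T u) (hl : 0 ≤ lam) {t : ℕ}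
    (ht : t < T) {φ : ℝ → ℝ} (hφ : Continuous φ) :
    IntegrableOn (fun x => φ (u t x) * GenShare.samplingDensity C lam α γ u t x) C := by
  obtain ⟨b, hb⟩ := (isCompact_Icc (a := 0) (b := H)).exists_bound_of_continuousOn hφ.continuousOn
  refine Integrable.bdd_mul (c := b) (h.integrableOn_samplingDensity hl ht.le)
    (hφ.measurable.comp (h.measurable t ht)).aestronglyMeasurable ?_
  exact (ae_restrict_iff' h.measurableSet).mpr
    (Filter.Eventually.of_forall fun x hx => hb _ (h.mem_Icc t ht x hx))

lemma IsRun.integrableOn_exp_mul_weight (h : IsRun C α H T u) (hl : 0 ≤ lam) {t : ℕ}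
    (ht : t < T) :
    IntegrableOn (fun x => Real.exp (lam * u t x) * GenShare.weight C lam α γ u t x) C := by
  refine ((h.integrableOn_comp_mul_samplingDensity (γ := γ) hl ht
    (φ := fun y => Real.exp (lam * y)) (by fun_prop)).mul_const
      (totalWeight C lam α γ u t)).congr (Filter.Eventually.of_forall fun x => ?_)
  simp only [samplingDensity_eq]
  rw [mul_assoc, div_mul_cancel₀ _ (h.totalWeight_pos hl ht.le).ne']

/-- Sharing weight does not change the total weight. -/
lemma IsRun.totalWeight_succ (h : IsRun C α H T u) (hl : 0 ≤ lam) {t : ℕ} (ht : t < T) :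
    totalWeight C lam α γ u (t + 1) =
      ∫ x in C, Real.exp (lam * u t x) * GenShare.weight C lam α γ u t x := by
  unfold totalWeight
  simp only [weight_succ]
  have hd : ∀ i : Fin (t + 1), IntegrableOn
      (fun x => shareCoeff γ t i * GenShare.samplingDensity C lam α γ u i x) C := fun i =>
    (h.integrableOn_samplingDensity hl (by omega)).const_mul _
  rw [integral_add ((h.integrableOn_exp_mul_weight hl ht).const_mul _)
    ((integrable_finsetSum _ fun i _ => hd i).const_mul _), integral_const_mul,
    integral_const_mul, integral_finsetSum _ fun i _ => hd i]
  have : ∀ i : Fin (t + 1), ∫ x in C, shareCoeff γ t i *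
      GenShare.samplingDensity C lam α γ u i x = shareCoeff γ t i := fun i => by
    rw [integral_const_mul, h.integral_samplingDensity hl (by omega), mul_one]
  simp only [this, sum_shareCoeff]
  ring

/-- The factor `W_{t+1} / W_t` by which the total weight grows in round `t`. -/
noncomputable def growth (C : Set (EuclideanSpace ℝ (Fin d))) (lam α γ : ℝ)
    (u : ℕ → EuclideanSpace ℝ (Fin d) → ℝ) (t : ℕ) : ℝ :=
  totalWeight C lam α γ u (t + 1) / totalWeight C lam α γ u t

lemma IsRun.growth_pos (h : IsRun C α H T u) (hl : 0 ≤ lam) {t : ℕ} (ht : t < T) :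
    0 < growth C lam α γ u t :=
  div_pos (h.totalWeight_pos hl ht) (h.totalWeight_pos hl ht.le)

lemma IsRun.growth_eq (h : IsRun C α H T u) (hl : 0 ≤ lam) {t : ℕ} (ht : t < T) :
    growth C lam α γ u t =
      ∫ x in C, Real.exp (lam * u t x) * GenShare.samplingDensity C lam α γ u t x := by
  unfold growth
  rw [h.totalWeight_succ hl ht, ← integral_div]
  simp only [samplingDensity_eq, mul_div_assoc]

/-- The expected utility of the forecaster in round `t`, given the past. -/
noncomputable def meanUtility (C : Set (EuclideanSpace ℝ (Fin d))) (lam α γ : ℝ)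
    (u : ℕ → EuclideanSpace ℝ (Fin d) → ℝ) (t : ℕ) : ℝ :=
  ∫ x in C, u t x * GenShare.samplingDensity C lam α γ u t x

lemma IsRun.log_growth_le (h : IsRun C α H T u) (hl : 0 ≤ lam) (hlH : lam * H ≤ 1) {t : ℕ}
    (ht : t < T) :
    Real.log (growth C lam α γ u t) ≤ lam * meanUtility C lam α γ u t + (lam * H) ^ 2 := by
  have hp := h.samplingDensity_pos (γ := γ) hl ht.le
  have key : growth C lam α γ u t ≤ 1 + lam * meanUtility C lam α γ u t + (lam * H) ^ 2 := by
    have h1 := h.integrableOn_samplingDensity (γ := γ) hl ht.le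
    have hu1 := h.integrableOn_comp_mul_samplingDensity (γ := γ) hl ht (φ := fun y => y)
      continuous_id
    calc growth C lam α γ u t
        = ∫ x in C, Real.exp (lam * u t x) * GenShare.samplingDensity C lam α γ u t x :=
          h.growth_eq hl ht
      _ ≤ ∫ x in C, (GenShare.samplingDensity C lam α γ u t x
            + lam * (u t x * GenShare.samplingDensity C lam α γ u t x)
            + (lam * H) ^ 2 * GenShare.samplingDensity C lam α γ u t x) := by
          refine setIntegral_mono_on (h.integrableOn_comp_mul_samplingDensity hl ht
            (φ := fun y => Real.exp (lam * y)) (by fun_prop))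
            ((h1.add (hu1.const_mul _)).add (h1.const_mul _)) h.measurableSet fun x hx => ?_
          obtain ⟨hx0, hx1⟩ := h.mem_Icc t ht x hx
          have hy0 : 0 ≤ lam * u t x := mul_nonneg hl hx0
          have hy1 : lam * u t x ≤ lam * H := mul_le_mul_of_nonneg_left hx1 hl
          have he := Real.abs_exp_sub_one_sub_id_le (x := lam * u t x)
            (by rw [abs_of_nonneg hy0]; linarith)
          have he' := (abs_le.mp he).2
          have : Real.exp (lam * u t x) ≤ 1 + lam * u t x + (lam * H) ^ 2 := by nlinarith
          calc _ ≤ (1 + lam * u t x + (lam * H) ^ 2) *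
                GenShare.samplingDensity C lam α γ u t x :=
                mul_le_mul_of_nonneg_right this (hp x).le
            _ = _ := by ring
      _ = 1 + lam * meanUtility C lam α γ u t + (lam * H) ^ 2 := by
          have h2 : IntegrableOn (fun x => GenShare.samplingDensity C lam α γ u t x
              + lam * (u t x * GenShare.samplingDensity C lam α γ u t x)) C :=
            h1.add (hu1.const_mul _)
          rw [integral_add h2 (h1.const_mul _),
            integral_add h1 (hu1.const_mul _), integral_const_mul, integral_const_mul,
            h.integral_samplingDensity hl ht.le]
          simp [meanUtility]
  have := Real.log_le_sub_one_of_pos (h.growth_pos (γ := γ) hl ht)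
  linarith

lemma IsRun.meanUtility_mem_Icc (h : IsRun C α H T u) (hl : 0 ≤ lam) {t : ℕ} (ht : t < T) :
    meanUtility C lam α γ u t ∈ Icc 0 H := by
  have hp := h.samplingDensity_pos (γ := γ) hl ht.le
  constructor
  · exact setIntegral_nonneg h.measurableSet fun x hx =>
      mul_nonneg (h.mem_Icc t ht x hx).1 (hp x).le
  · have := setIntegral_mono_on (h.integrableOn_comp_mul_samplingDensity (γ := γ) hl ht
      (φ := fun y => y) continuous_id)
      ((h.integrableOn_samplingDensity (γ := γ) hl ht.le).const_mul H) h.measurableSet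
      fun x hx => mul_le_mul_of_nonneg_right (h.mem_Icc t ht x hx).2 (hp x).le
    rwa [integral_const_mul, h.integral_samplingDensity hl ht.le, mul_one] at this

lemma IsRun.samplingDensity_succ (h : IsRun C α H T u) (hl : 0 ≤ lam) {t : ℕ} (ht : t < T)
    (x : EuclideanSpace ℝ (Fin d)) :
    GenShare.samplingDensity C lam α γ u (t + 1) x =
      (1 - α) * Real.exp (lam * u t x) / growth C lam α γ u t *
        GenShare.samplingDensity C lam α γ u t x
      + α * ∑ i : Fin (t + 1), shareCoeff γ t i * GenShare.samplingDensity C lam α γ u i x := by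
  have h1 := (h.totalWeight_pos (γ := γ) hl (Nat.succ_le_of_lt ht)).ne'
  have h0 := (h.totalWeight_pos (γ := γ) hl ht.le).ne'
  rw [samplingDensity_eq (t + 1), weight_succ, ← h.totalWeight_succ hl ht, samplingDensity_eq t,
    growth]
  field_simp

/-- Staying with the expert `x` in round `t`. -/
lemma IsRun.log_density_step (h : IsRun C α H T u) (hl : 0 ≤ lam) {t : ℕ} (ht : t < T)
    (x : EuclideanSpace ℝ (Fin d)) :
    Real.log (1 - α) + lam * u t x - Real.log (growth C lam α γ u t)
      + Real.log (GenShare.samplingDensity C lam α γ u t x)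
      ≤ Real.log (GenShare.samplingDensity C lam α γ u (t + 1) x) := by
  have hp := h.samplingDensity_pos (γ := γ) hl ht.le x
  have hg := h.growth_pos (γ := γ) hl ht
  have hα1 := sub_pos.mpr h.rate_lt_one
  have hle : (1 - α) * Real.exp (lam * u t x) / growth C lam α γ u t *
        GenShare.samplingDensity C lam α γ u t x
      ≤ GenShare.samplingDensity C lam α γ u (t + 1) x := by
    rw [h.samplingDensity_succ hl ht]
    refine le_add_of_nonneg_right (mul_nonneg h.rate_pos.le (Finset.sum_nonneg fun i _ =>
      mul_nonneg (shareCoeff_pos _ _ _).le (h.samplingDensity_pos hl (by omega) x).le))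
  have := Real.log_le_log (by positivity) hle
  rwa [Real.log_mul (by positivity) hp.ne', Real.log_div (by positivity) hg.ne',
    Real.log_mul hα1.ne' (Real.exp_pos _).ne', Real.log_exp] at this

/-- Returning in round `t + 1` to the expert `x`, which was left in round `i`. -/
lemma IsRun.log_density_return (h : IsRun C α H T u) (hl : 0 ≤ lam) (hγ : 0 < γ) (hγ1 : γ ≤ 1)
    {t i : ℕ} (ht : t < T) (hi : i ≤ t) (x : EuclideanSpace ℝ (Fin d)) :
    Real.log (α * γ / 2) - γ * ((t : ℝ) - i)
      + Real.log (GenShare.samplingDensity C lam α γ u i x)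
      ≤ Real.log (GenShare.samplingDensity C lam α γ u (t + 1) x) := by
  have hα := h.rate_pos
  have hα1 := sub_pos.mpr h.rate_lt_one
  have hp := h.samplingDensity_pos (γ := γ) hl ht.le x
  have hg := h.growth_pos (γ := γ) hl ht
  have hpi := h.samplingDensity_pos (γ := γ) hl (hi.trans ht.le) x
  have hle : α * γ / 2 * Real.exp (-γ * ((t : ℝ) - i)) * GenShare.samplingDensity C lam α γ u i x
      ≤ GenShare.samplingDensity C lam α γ u (t + 1) x := by
    rw [h.samplingDensity_succ hl ht]
    refine le_add_of_nonneg_of_le (by positivity) ?_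
    have h1 : shareCoeff γ t i * GenShare.samplingDensity C lam α γ u i x ≤
        ∑ j : Fin (t + 1), shareCoeff γ t j * GenShare.samplingDensity C lam α γ u j x := by
      have hnn : ∀ j ∈ (Finset.univ : Finset (Fin (t + 1))),
          0 ≤ shareCoeff γ t j * GenShare.samplingDensity C lam α γ u j x := fun j _ =>
        mul_nonneg (shareCoeff_pos _ _ _).le
          (h.samplingDensity_pos hl (by have := j.2; omega) x).le
      obtain ⟨j, rfl⟩ : ∃ j : Fin (t + 1), (j : ℕ) = i := ⟨⟨i, by omega⟩, rfl⟩
      exact Finset.single_le_sum hnn (Finset.mem_univ j)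
    calc _ = α * (γ / 2 * Real.exp (-γ * ((t : ℝ) - i)) *
          GenShare.samplingDensity C lam α γ u i x) := by ring
      _ ≤ α * (shareCoeff γ t i * GenShare.samplingDensity C lam α γ u i x) := by
          have := half_mul_exp_le_shareCoeff hγ hγ1 t i
          gcongr
      _ ≤ _ := by gcongr
  have := Real.log_le_log (by positivity) hle
  rw [Real.log_mul (by positivity) hpi.ne', Real.log_mul (by positivity) (Real.exp_pos _).ne',
    Real.log_exp] at this
  linarith

end Weights

/-! ### Tracking the experts of an offline strategy -/

section Tracking

/-- The round after the last one before `t` in which the strategy `a` plays `v`, and `0` if there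
is none. -/
noncomputable def lastLeft {E : Type*} (a : ℕ → E) (v : E) : ℕ → ℕ
  | 0 => 0
  | t + 1 => open Classical in if a t = v then t + 1 else lastLeft a v t

lemma lastLeft_le {E : Type*} (a : ℕ → E) (v : E) (t : ℕ) : lastLeft a v t ≤ t := by
  induction t with
  | zero => simp [lastLeft]
  | succ t ih => rw [lastLeft]; split_ifs <;> omega

variable {d : ℕ} {C : Set (EuclideanSpace ℝ (Fin d))} {lam α γ H : ℝ} {T : ℕ}
  {u : ℕ → EuclideanSpace ℝ (Fin d) → ℝ}

open Classical in
/-- The density at `x` pays the factor `(1 - α) exp (lam u_t(x)) / (W_{t+1} / W_t)` only in the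
rounds in which the strategy plays `v`; the rounds in between cost a factor `α γ / 2` at each
return to `v`, and a discount whose exponents add up to at most `γ` times the time elapsed. -/
lemma IsRun.log_density_track (h : IsRun C α H T u) (hl : 0 ≤ lam) (hγ : 0 < γ) (hγ1 : γ ≤ 1)
    (a : ℕ → EuclideanSpace ℝ (Fin d)) (v x : EuclideanSpace ℝ (Fin d)) {t : ℕ} (ht : t ≤ T) :
    Real.log (GenShare.samplingDensity C lam α γ u 0 x)
      + ∑ i ∈ Finset.range t, (if a i = v then
          Real.log (1 - α) + lam * u i x - Real.log (growth C lam α γ u i) else 0)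
      + ∑ i ∈ Finset.range t, (if a i = v ∧ lastLeft a v i ≠ i then Real.log (α * γ / 2) else 0)
      - γ * lastLeft a v t
      ≤ Real.log (GenShare.samplingDensity C lam α γ u (lastLeft a v t) x) := by
  induction t with
  | zero => simp [lastLeft]
  | succ t ih =>
    have ih := ih (by omega)
    rw [Finset.sum_range_succ, Finset.sum_range_succ, lastLeft]
    by_cases hv : a t = v
    · have hstep := h.log_density_step (γ := γ) hl (t := t) (by omega) x
      by_cases hL : lastLeft a v t = t
      · rw [hL] at ih
        simp only [hv, hL, if_true, true_and, ne_eq, not_true, if_false]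
        push_cast
        linarith
      · have hlt := lt_of_le_of_ne (lastLeft_le a v t) hL
        obtain ⟨k, rfl⟩ : ∃ k, t = k + 1 := ⟨t - 1, by omega⟩
        have hret := h.log_density_return (γ := γ) hl hγ hγ1 (t := k)
          (i := lastLeft a v (k + 1)) (by omega) (by omega) x
        simp only [hv, hL, if_true, true_and, ne_eq, not_false_eq_true]
        push_cast
        linarith
    · simp only [hv, if_false, false_and]
      linarith

lemma samplingDensity_zero (x : EuclideanSpace ℝ (Fin d)) :
    GenShare.samplingDensity C lam α γ u 0 x = (volume.real C)⁻¹ := by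
  simp [samplingDensity_eq, totalWeight, weight_zero]

open Classical in
/-- The mass which the forecaster gives to `C ∩ ball v r` when the strategy leaves `v` for the last
time is at most `1`. -/
lemma IsRun.log_mass_le (h : IsRun C α H T u) (hl : 0 ≤ lam) (hγ : 0 < γ) (hγ1 : γ ≤ 1)
    (a : ℕ → EuclideanSpace ℝ (Fin d)) (v : EuclideanSpace ℝ (Fin d)) {r θ b : ℝ} (hθ : 0 < θ)
    (hvol : θ * volume.real C ≤ volume.real (C ∩ ball v r))
    (hb : ∀ x ∈ C ∩ ball v r, b ≤ ∑ t ∈ Finset.range T, if a t = v then u t x else 0) :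
    Real.log θ + ∑ t ∈ Finset.range T, (if a t = v then
          Real.log (1 - α) - Real.log (growth C lam α γ u t) else 0) + lam * b
      + ∑ t ∈ Finset.range T, (if a t = v ∧ lastLeft a v t ≠ t then Real.log (α * γ / 2) else 0)
      - γ * T ≤ 0 := by
  have hC : 0 < volume.real C := ENNReal.toReal_pos h.volume_pos.ne' h.volume_ne_top
  set S := ∑ t ∈ Finset.range T, (if a t = v then
    Real.log (1 - α) - Real.log (growth C lam α γ u t) else 0) with hS
  set J := ∑ t ∈ Finset.range T,
    (if a t = v ∧ lastLeft a v t ≠ t then Real.log (α * γ / 2) else 0) with hJ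
  have hLT := lastLeft_le a v T
  set τ := lastLeft a v T with hτ
  set k := -Real.log (volume.real C) + S + lam * b + J - γ * T with hk
  have hpt : ∀ x ∈ C ∩ ball v r, Real.exp k ≤ GenShare.samplingDensity C lam α γ u τ x := by
    intro x hx
    rw [← Real.le_log_iff_exp_le (h.samplingDensity_pos hl hLT x)]
    refine le_trans ?_ (h.log_density_track hl hγ hγ1 a v x le_rfl)
    rw [samplingDensity_zero, Real.log_inv]
    have hsplit : ∑ t ∈ Finset.range T, (if a t = v then
          Real.log (1 - α) + lam * u t x - Real.log (growth C lam α γ u t) else 0)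
        = S + lam * ∑ t ∈ Finset.range T, (if a t = v then u t x else 0) := by
      rw [hS, Finset.mul_sum, ← Finset.sum_add_distrib]
      refine Finset.sum_congr rfl fun t _ => ?_
      split_ifs <;> ring
    rw [hsplit]
    have h1 := mul_le_mul_of_nonneg_left (hb x hx) hl
    have h2 : γ * (τ : ℝ) ≤ γ * T := mul_le_mul_of_nonneg_left (Nat.cast_le.mpr hLT) hγ.le
    linarith
  have hmeas : MeasurableSet (C ∩ ball v r) := h.measurableSet.inter measurableSet_ball
  have hfin : volume (C ∩ ball v r) ≠ ⊤ := measure_ne_top_of_subset inter_subset_left h.volume_ne_top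
  have hint := h.integrableOn_samplingDensity (γ := γ) hl hLT
  have hmass : Real.exp k * (θ * volume.real C) ≤ 1 := by
    calc Real.exp k * (θ * volume.real C) ≤ Real.exp k * volume.real (C ∩ ball v r) := by gcongr
      _ = ∫ x in C ∩ ball v r, Real.exp k := by
          rw [setIntegral_const, smul_eq_mul, mul_comm]
      _ ≤ ∫ x in C ∩ ball v r, GenShare.samplingDensity C lam α γ u τ x :=
          setIntegral_mono_on (integrableOn_const hfin) (hint.mono_set inter_subset_left) hmeas hpt
      _ ≤ ∫ x in C, GenShare.samplingDensity C lam α γ u τ x :=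
          setIntegral_mono_set hint (Filter.Eventually.of_forall fun x =>
            (h.samplingDensity_pos hl hLT x).le) inter_subset_left.eventuallyLE
      _ = 1 := h.integral_samplingDensity hl hLT
  have := Real.log_nonpos (by positivity) hmass
  rw [Real.log_mul (Real.exp_pos _).ne' (by positivity), Real.log_exp,
    Real.log_mul hθ.ne' hC.ne'] at this
  linarith

lemma card_nonLipschitz_le {L : ℝ≥0} {v : EuclideanSpace ℝ (Fin d)} (hv : v ∈ C) (r : ℝ)
    [DecidablePred fun t => LipschitzOnWith L (u t) (ball v r ∩ C)] :
    (((Finset.range T).filter fun t => ¬ LipschitzOnWith L (u t) (ball v r ∩ C)).card : ℝ)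
      ≤ GenShare.nonLipschitzCount C L T u r := by
  have hset : ∀ w : EuclideanSpace ℝ (Fin d),
      {t : ℕ | t < T ∧ ¬ LipschitzOnWith L (u t) (ball w r ∩ C)} ⊆ (Finset.range T : Set ℕ) :=
    fun w t ht => by simpa using ht.1
  have hbdd : BddAbove (range fun ρ : C =>
      ((({t : ℕ | t < T ∧ ¬ LipschitzOnWith L (u t)
        (ball (ρ : EuclideanSpace ℝ (Fin d)) r ∩ C)} : Set ℕ).ncard : ℕ) : ℝ)) := by
    refine ⟨T, ?_⟩
    rintro _ ⟨ρ, rfl⟩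
    have := Set.ncard_le_ncard (hset ρ) (Finset.finite_toSet _)
    rw [Set.ncard_coe_finset, Finset.card_range] at this
    exact Nat.cast_le.mpr this
  refine le_trans (le_of_eq ?_) (le_ciSup hbdd ⟨v, hv⟩)
  rw [← Set.ncard_coe_finset]
  congr 2
  ext t
  simp

lemma nonLipschitzCount_nonneg (L : ℝ≥0) (r : ℝ) : 0 ≤ GenShare.nonLipschitzCount C L T u r :=
  Real.iSup_nonneg fun _ => Nat.cast_nonneg _

open Classical in
/-- In a set of rounds, playing points `v t` of a ball can be replaced by playing points `x t` at
distance at most `δ` from them in the same ball. -/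
lemma IsRun.sum_utility_near (h : IsRun C α H T u) {L : ℝ≥0} (hH : 0 ≤ H)
    (p : ℕ → Prop) [DecidablePred p] {w : EuclideanSpace ℝ (Fin d)}
    {v x : ℕ → EuclideanSpace ℝ (Fin d)} {r δ : ℝ} (hw : w ∈ C) (hδ0 : 0 ≤ δ)
    (hv : ∀ t < T, p t → v t ∈ ball w r ∩ C) (hx : ∀ t < T, p t → x t ∈ ball w r ∩ C)
    (hδ : ∀ t < T, p t → dist (v t) (x t) ≤ δ) :
    ∑ t ∈ Finset.range T, (if p t then u t (v t) - L * δ else 0)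
        - H * GenShare.nonLipschitzCount C L T u r
      ≤ ∑ t ∈ Finset.range T, (if p t then u t (x t) else 0) := by
  have hcard := card_nonLipschitz_le (u := u) (T := T) (L := L) hw r
  have hterm : ∀ t ∈ Finset.range T, (if p t then u t (v t) - L * δ else 0)
      ≤ (if p t then u t (x t) else 0)
        + if ¬ LipschitzOnWith L (u t) (ball w r ∩ C) then H else 0 := by
    intro t ht
    have ht := Finset.mem_range.mp ht
    have hδ0 : 0 ≤ L * δ := mul_nonneg L.2 hδ0
    by_cases hp : p t
    · have hv := hv t ht hp
      have hx := hx t ht hp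
      simp only [hp, if_true]
      by_cases hL : LipschitzOnWith L (u t) (ball w r ∩ C)
      · simp only [hL, not_true, if_false, add_zero]
        have := hL.dist_le_mul (v t) hv (x t) hx
        have h2 := (abs_le.mp (this.trans (mul_le_mul_of_nonneg_left (hδ t ht hp) L.2))).2
        change u t (v t) - u t (x t) ≤ L * δ at h2
        linarith
      · simp only [hL, not_false_eq_true, if_true]
        have h1 := (h.mem_Icc t ht _ hv.2).2
        have h2 := (h.mem_Icc t ht _ hx.2).1
        linarith
    · simp only [hp, if_false, zero_add]
      split_ifs <;> simp [hH]
  have hsum := Finset.sum_le_sum hterm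
  rw [Finset.sum_add_distrib, ← Finset.sum_filter (fun t =>
    ¬ LipschitzOnWith L (u t) (ball w r ∩ C)), Finset.sum_const, nsmul_eq_mul] at hsum
  have := mul_le_mul_of_nonneg_right hcard hH
  linarith

open Classical in
/-- The forecaster competes with every strategy `a` which plays at most `m` distinct experts,
all of them thick points of `C`, and switches at most `s` times. -/
theorem IsRun.strategy_le (h : IsRun C α H T u) (hl : 0 ≤ lam) (hH : 0 ≤ H) (hlH : lam * H ≤ 1)
    (hγ : 0 < γ) (hγ1 : γ ≤ 1) {L : ℝ≥0} {r θ : ℝ} (hr : 0 < r) (hθ : 0 < θ) (hθ1 : θ ≤ 1)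
    {m s : ℕ} (a : ℕ → EuclideanSpace ℝ (Fin d)) (haC : ∀ t < T, a t ∈ C)
    (ha : ∀ t < T, θ * volume.real C ≤ volume.real (C ∩ ball (a t) r))
    (hm : ((Finset.range T).image a).card ≤ m)
    (hs : ((Finset.range T).filter fun t => t ≠ 0 ∧ a (t - 1) ≠ a t).card ≤ s) :
    lam * ∑ t ∈ Finset.range T, u t (a t) ≤
      lam * ∑ t ∈ Finset.range T, meanUtility C lam α γ u t + T * (lam * H) ^ 2
      + lam * (L * r * T + m * (H * GenShare.nonLipschitzCount C L T u r))
      + m * (γ * T - Real.log θ) - s * Real.log (α * γ / 2) - T * Real.log (1 - α) := by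
  set N := GenShare.nonLipschitzCount C L T u r with hN
  have hN0 : 0 ≤ N := nonLipschitzCount_nonneg L r
  set V := (Finset.range T).image a with hV
  have hα := h.rate_pos
  have hα1 := h.rate_lt_one
  have hper : ∀ v ∈ V, Real.log θ + ∑ t ∈ Finset.range T, (if a t = v then
          Real.log (1 - α) - Real.log (growth C lam α γ u t) else 0)
      + lam * (∑ t ∈ Finset.range T, (if a t = v then u t v - L * r else 0) - H * N)
      + ∑ t ∈ Finset.range T, (if a t = v ∧ lastLeft a v t ≠ t then Real.log (α * γ / 2) else 0)
      - γ * T ≤ 0 := by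
    intro v hv
    obtain ⟨t, ht, rfl⟩ := Finset.mem_image.mp hv
    have ht := Finset.mem_range.mp ht
    refine h.log_mass_le hl hγ hγ1 a (a t) hθ (ha t ht) fun x hx => ?_
    have hnear := h.sum_utility_near (L := L) hH (fun i => a i = a t) (v := fun _ => a t)
      (x := fun _ => x) (r := r) (haC t ht) hr.le (fun _ _ _ => ⟨mem_ball_self hr, haC t ht⟩)
      (fun _ _ _ => ⟨hx.2, hx.1⟩) (fun _ _ _ => by rw [dist_comm]; exact (mem_ball.mp hx.2).le)
    exact hnear
  have hsum := Finset.sum_nonpos hper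
  have hmem : ∀ t ∈ Finset.range T, a t ∈ V := fun t ht => Finset.mem_image_of_mem a ht
  have hswap : ∀ f : ℕ → EuclideanSpace ℝ (Fin d) → ℝ,
      ∑ v ∈ V, ∑ t ∈ Finset.range T, (if a t = v then f t v else 0)
        = ∑ t ∈ Finset.range T, f t (a t) := by
    intro f
    rw [Finset.sum_comm]
    refine Finset.sum_congr rfl fun t ht => ?_
    rw [Finset.sum_ite_eq, if_pos (hmem t ht)]
  have hret : s * Real.log (α * γ / 2) ≤ ∑ v ∈ V, ∑ t ∈ Finset.range T,
      (if a t = v ∧ lastLeft a v t ≠ t then Real.log (α * γ / 2) else 0) := by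
    have hc : Real.log (α * γ / 2) ≤ 0 :=
      Real.log_nonpos (by positivity) (by nlinarith)
    simp only [ite_and]
    rw [hswap fun t v => if lastLeft a v t ≠ t then Real.log (α * γ / 2) else 0,
      ← Finset.sum_filter, Finset.sum_const, nsmul_eq_mul]
    refine mul_le_mul_of_nonpos_right (Nat.cast_le.mpr (le_trans (Finset.card_le_card ?_) hs)) hc
    intro t ht
    rw [Finset.mem_filter] at ht ⊢
    refine ⟨ht.1, ?_⟩
    rcases t with _ | t
    · simp [lastLeft] at ht
    · refine ⟨by omega, fun heq => ht.2 ?_⟩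
      rw [lastLeft]
      exact if_pos heq
  simp only [Finset.sum_sub_distrib, Finset.sum_add_distrib, ← Finset.mul_sum] at hsum
  rw [hswap fun t _ => Real.log (1 - α) - Real.log (growth C lam α γ u t),
    hswap fun t v => u t v - L * r] at hsum
  simp only [Finset.sum_sub_distrib, Finset.sum_const, nsmul_eq_mul, Finset.card_range] at hsum
  have hZ : ∑ t ∈ Finset.range T, Real.log (growth C lam α γ u t) ≤
      lam * ∑ t ∈ Finset.range T, meanUtility C lam α γ u t + T * (lam * H) ^ 2 := by
    have := Finset.sum_le_sum fun t (ht : t ∈ Finset.range T) =>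
      h.log_growth_le (γ := γ) hl hlH (Finset.mem_range.mp ht)
    rwa [Finset.sum_add_distrib, ← Finset.mul_sum, Finset.sum_const, nsmul_eq_mul,
      Finset.card_range] at this
  have hVm : (V.card : ℝ) * (γ * T - Real.log θ + lam * (H * N))
      ≤ m * (γ * T - Real.log θ + lam * (H * N)) := by
    refine mul_le_mul_of_nonneg_right (Nat.cast_le.mpr hm) ?_
    have := Real.log_nonpos hθ.le hθ1
    have : 0 ≤ γ * T := by positivity
    have : 0 ≤ lam * (H * N) := by positivity
    linarith
  linarith

/-- An offline strategy given by `s` phases, as the sequence of the experts played. -/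
lemma exists_strategy_of_mem_offlinePayoffs {D : Set (EuclideanSpace ℝ (Fin d))} {m s : ℕ}
    (hs : 1 ≤ s) {y : ℝ} (hy : y ∈ GenShare.offlinePayoffs D m s T u) :
    ∃ a : ℕ → EuclideanSpace ℝ (Fin d), (∀ t, a t ∈ D) ∧
      (∀ S : Finset (EuclideanSpace ℝ (Fin d)), (∀ x ∈ S, x ∈ range a) → S.card ≤ m) ∧
      (∀ S : Finset ℕ, (∀ t ∈ S, t < T ∧ t ≠ 0 ∧ a (t - 1) ≠ a t) → S.card ≤ s) ∧
      y = ∑ t ∈ Finset.range T, u t (a t) := by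
  obtain ⟨τ, ρ, hτ, hτ0, hτT, hρD, hρm, rfl⟩ := hy
  have : Nonempty (Fin s) := ⟨⟨0, hs⟩⟩
  have hex : ∀ j : Fin (s + 1), ∀ t < τ j, ∃ i : Fin s, τ i.castSucc ≤ t ∧ t < τ i.succ := by
    intro j
    induction j using Fin.induction with
    | zero => intro t ht; omega
    | succ j ih =>
      intro t ht
      by_cases h : t < τ j.castSucc
      · exact ih t h
      · exact ⟨j, not_lt.mp h, ht⟩
  have huniq : ∀ t, ∀ i j : Fin s, τ i.castSucc ≤ t → t < τ i.succ → τ j.castSucc ≤ t →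
      t < τ j.succ → i = j := by
    have key : ∀ t, ∀ i j : Fin s, t < τ i.succ → τ j.castSucc ≤ t → ¬ i < j := by
      intro t i j hi hj hij
      have : τ i.succ ≤ τ j.castSucc := hτ.monotone (Fin.succ_le_castSucc_iff.mpr hij)
      omega
    intro t i j h1 h2 h3 h4
    exact le_antisymm (not_lt.mp (key t j i h4 h1)) (not_lt.mp (key t i j h2 h3))
  choose! φ hφ using fun t (ht : t < T) => hex (Fin.last s) t (hτT ▸ ht)
  refine ⟨fun t => ρ (φ t), fun t => hρD _, fun S hS => ?_, fun S hS => ?_, ?_⟩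
  · refine le_trans ?_ hρm
    rw [← Set.ncard_coe_finset]
    refine Set.ncard_le_ncard (fun x hx => ?_) (finite_range ρ)
    obtain ⟨t, rfl⟩ := hS x hx
    exact mem_range_self _
  · -- a switch takes place at the first round of a phase
    have hsub : S ⊆ Finset.univ.image fun i : Fin s => τ i.castSucc := by
      intro t ht
      obtain ⟨htT, ht0, hne⟩ := hS t ht
      refine Finset.mem_image.mpr ⟨φ t, Finset.mem_univ _, ?_⟩
      obtain ⟨h1, h2⟩ := hφ t htT
      by_contra hlt
      obtain ⟨h3, h4⟩ := hφ (t - 1) (by omega)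
      exact hne (congrArg ρ (huniq (t - 1) _ _ h3 h4 (by omega) (by omega)))
    exact (Finset.card_le_card hsub).trans (Finset.card_image_le.trans (by simp))
  · rw [← Finset.sum_fiberwise (Finset.range T) φ]
    refine Finset.sum_congr rfl fun i _ => Finset.sum_congr ?_ fun t ht => ?_
    · ext t
      simp only [Finset.mem_Ico, Finset.mem_filter, Finset.mem_range]
      constructor
      · rintro ⟨h1, h2⟩
        have htT : t < T := hτT ▸ h2.trans_le (hτ.monotone (Fin.le_last _))
        exact ⟨htT, huniq t _ _ (hφ t htT).1 (hφ t htT).2 h1 h2⟩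
      · rintro ⟨htT, rfl⟩
        exact hφ t htT
    · simp only [(Finset.mem_filter.mp ht).2]

end Tracking

/-! ### The law of the actions -/

section Law

/-- If `X` has conditional density `p` with respect to `μ` given `π`, then the joint law of
`(π, X)` disintegrates accordingly. -/
lemma lintegral_comp_eq_of_conditional_density {Ω Ω' E : Type*} [MeasurableSpace Ω]
    [MeasurableSpace Ω'] [MeasurableSpace E] {P : Measure Ω} [IsFiniteMeasure P] {π : Ω → Ω'}
    (hπ : Measurable π) {X : Ω → E} (hX : Measurable X) {μ : Measure E} [SFinite μ]
    {p : Ω' × E → ENNReal} (hp : Measurable p)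
    (hlaw : ∀ B, MeasurableSet B → ∀ A, MeasurableSet A →
      P (π ⁻¹' B ∩ X ⁻¹' A) = ∫⁻ ω in π ⁻¹' B, ∫⁻ x in A, p (π ω, x) ∂μ ∂P)
    {f : Ω' × E → ENNReal} (hf : Measurable f) :
    ∫⁻ ω, f (π ω, X ω) ∂P = ∫⁻ ω, ∫⁻ x, p (π ω, x) * f (π ω, x) ∂μ ∂P := by
  have hjoint : P.map (fun ω => (π ω, X ω)) = ((P.map π).prod μ).withDensity p := by
    refine Measure.ext_prod fun {B A} hB hA => ?_
    rw [Measure.map_apply (hπ.prodMk hX) (hB.prod hA), withDensity_apply _ (hB.prod hA),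
      ← Measure.prod_restrict, lintegral_prod _ hp.aemeasurable,
      Measure.restrict_map hπ hB, lintegral_map hp.lintegral_prod_right' hπ]
    exact hlaw B hB A hA
  rw [← lintegral_map hf (hπ.prodMk hX), hjoint, lintegral_withDensity_eq_lintegral_mul _ hp hf,
    lintegral_prod _ (hp.mul hf).aemeasurable, lintegral_map (hp.mul hf).lintegral_prod_right' hπ]
  rfl

variable {d : ℕ} {C : Set (EuclideanSpace ℝ (Fin d))} {lam α γ H : ℝ} {T : ℕ}

/-- The forecaster's utility in round `t` has the expectation of `meanUtility`. The map `π`, from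
the probability space to the space of histories, is there to separate the σ-algebra of the past
from the one of the probability space. -/
lemma integral_utility_action {Ω Ω' : Type*} [MeasurableSpace Ω] [MeasurableSpace Ω']
    {P : Measure Ω} [IsProbabilityMeasure P] {π : Ω → Ω'} (hπ : Measurable π)
    {X : Ω → EuclideanSpace ℝ (Fin d)} (hX : Measurable X)
    {U : ℕ → Ω' → EuclideanSpace ℝ (Fin d) → ℝ} {t : ℕ} (ht : t < T) (hl : 0 ≤ lam)
    (hrun : ∀ ω, IsRun C α H T (fun i => U i ω))
    (hU : ∀ i ≤ t, Measurable fun z : Ω' × EuclideanSpace ℝ (Fin d) => U i z.1 z.2)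
    (hlaw : ∀ B, MeasurableSet B → ∀ A, MeasurableSet A →
      P (π ⁻¹' B ∩ X ⁻¹' A) = ∫⁻ ω in π ⁻¹' B, ∫⁻ ρ in A ∩ C, ENNReal.ofReal
        (GenShare.samplingDensity C lam α γ (fun i => U i (π ω)) t ρ) ∂volume ∂P) :
    (∀ᵐ ω ∂P, X ω ∈ C) ∧ Integrable (fun ω => U t (π ω) (X ω)) P ∧
      Integrable (fun ω => meanUtility C lam α γ (fun i => U i (π ω)) t) P ∧
      ∫ ω, U t (π ω) (X ω) ∂P = ∫ ω, meanUtility C lam α γ (fun i => U i (π ω)) t ∂P := by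
  obtain ⟨ω₀⟩ : Nonempty Ω := nonempty_of_isProbabilityMeasure P
  have hC := (hrun (π ω₀)).measurableSet
  have hXC : ∀ᵐ ω ∂P, X ω ∈ C := by
    have := hlaw univ MeasurableSet.univ Cᶜ hC.compl
    rw [compl_inter_self] at this
    have h0 : P (X ⁻¹' Cᶜ) = 0 := by simpa using this
    exact h0
  have hw : Measurable fun z : Ω' × EuclideanSpace ℝ (Fin d) =>
      GenShare.weight C lam α γ (fun i => U i z.1) t z.2 :=
    measurable_weight t fun i hi => hU i hi.le
  have hint : ∀ f : Ω' × EuclideanSpace ℝ (Fin d) → ℝ, Measurable f →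
      Measurable fun ω => ∫ y in C, f (ω, y) :=
    fun f hf => (hf.stronglyMeasurable.integral_prod_right' (ν := volume.restrict C)).measurable
  have hp : Measurable fun z : Ω' × EuclideanSpace ℝ (Fin d) =>
      GenShare.samplingDensity C lam α γ (fun i => U i z.1) t z.2 :=
    hw.div ((hint _ hw).comp measurable_fst)
  have hg : Measurable fun ω => meanUtility C lam α γ (fun i => U i (π ω)) t :=
    (hint (fun z => U t z.1 z.2 * GenShare.samplingDensity C lam α γ (fun i => U i z.1) t z.2)
      ((hU t le_rfl).mul hp)).comp hπ
  have hUX : Measurable fun ω => U t (π ω) (X ω) := (hU t le_rfl).comp (hπ.prodMk hX)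
  have hgmem := fun ω => (hrun (π ω)).meanUtility_mem_Icc (γ := γ) hl ht
  have hUmem : ∀ᵐ ω ∂P, U t (π ω) (X ω) ∈ Icc 0 H := by
    filter_upwards [hXC] with ω hω using (hrun (π ω)).mem_Icc t ht _ hω
  refine ⟨hXC, Integrable.of_bound hUX.aestronglyMeasurable H ?_,
    Integrable.of_bound hg.aestronglyMeasurable H ?_, ?_⟩
  · filter_upwards [hUmem] with ω hω
    rw [Real.norm_of_nonneg hω.1]
    exact hω.2
  · refine Filter.Eventually.of_forall fun ω => ?_
    rw [Real.norm_of_nonneg (hgmem ω).1]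
    exact (hgmem ω).2
  rw [integral_eq_lintegral_of_nonneg_ae (hUmem.mono fun ω hω => hω.1) hUX.aestronglyMeasurable,
    integral_eq_lintegral_of_nonneg_ae (Filter.Eventually.of_forall fun ω => (hgmem ω).1)
      hg.aestronglyMeasurable]
  congr 1
  have key := lintegral_comp_eq_of_conditional_density (P := P) hπ hX (μ := volume.restrict C)
    hp.ennreal_ofReal
    (fun B hB A hA => by rw [hlaw B hB A hA, Measure.restrict_restrict hA])
    (hU t le_rfl).ennreal_ofReal
  rw [key]
  refine lintegral_congr fun ω => ?_
  have hr := hrun (π ω)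
  have hd := hr.samplingDensity_pos (γ := γ) hl ht.le
  rw [meanUtility, ofReal_integral_eq_lintegral_ofReal
    (hr.integrableOn_comp_mul_samplingDensity hl ht (φ := fun y => y) continuous_id)
    ((ae_restrict_iff' hC).mpr (Filter.Eventually.of_forall fun x hx =>
      mul_nonneg (hr.mem_Icc t ht x hx).1 (hd x).le))]
  refine lintegral_congr fun x => ?_
  rw [mul_comm (U t (π ω) x), ENNReal.ofReal_mul (hd x).le]

end Law

/-! ### Upper expectations -/

lemma expectationLE_mono {Ω : Type*} [MeasurableSpace Ω] {P : Measure Ω} {Z Z' : Ω → ℝ} {b b' : ℝ}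
    (h : GenShare.ExpectationLE P Z b) (hZ : ∀ᵐ ω ∂P, Z' ω ≤ Z ω) (hb : b ≤ b') :
    GenShare.ExpectationLE P Z' b' := by
  obtain ⟨Y, hY, hZY, hYb⟩ := h
  exact ⟨Y, hY, by filter_upwards [hZ, hZY] with ω h1 h2 using h1.trans h2, hYb.trans hb⟩

lemma expectationLE_affine {Ω : Type*} [MeasurableSpace Ω] {P : Measure Ω} [IsProbabilityMeasure P]
    {Z W : Ω → ℝ} {b : ℝ} (h : GenShare.ExpectationLE P Z b) (hW : Integrable W P) {k : ℝ}
    (hk : 0 ≤ k) (c : ℝ) :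
    GenShare.ExpectationLE P (fun ω => k * Z ω + W ω + c) (k * b + ∫ ω, W ω ∂P + c) := by
  obtain ⟨Y, hY, hZY, hYb⟩ := h
  refine ⟨fun ω => k * Y ω + W ω + c, ((hY.const_mul k).add hW).add (integrable_const c), ?_, ?_⟩
  · filter_upwards [hZY] with ω hω
    have := mul_le_mul_of_nonneg_left hω hk
    linarith
  · have h1 : Integrable (fun ω => k * Y ω + W ω) P := (hY.const_mul k).add hW
    rw [integral_add h1 (integrable_const c), integral_add (hY.const_mul k) hW,
      integral_const_mul, integral_const]
    have := mul_le_mul_of_nonneg_left hYb hk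
    simp
    linarith

/-! ### Tuning the parameters -/

/-- With `α = s / T` and `γ = s / (m T)`, the price of tracking an offline strategy is a multiple of
the complexity `m d log (R / r) + s log (m T / s)`. -/
lemma tracking_cost_le {d m s T : ℕ} {ℓ : ℝ} (hm : 1 ≤ m) (hs : 1 ≤ s) (hT : 2 * s ≤ T) :
    m * ((s : ℝ) / (m * T) * T + 2 * d * ℓ) - s * Real.log ((s : ℝ) / T * (s / (m * T)) / 2)
        - T * Real.log (1 - (s : ℝ) / T)
      ≤ 2 * (m * d * ℓ) + 8 * (s * Real.log (m * T / s)) := by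
  have hm' : (1 : ℝ) ≤ m := by exact_mod_cast hm
  have hs' : (1 : ℝ) ≤ s := by exact_mod_cast hs
  have hT' : 2 * (s : ℝ) ≤ T := by exact_mod_cast hT
  have hT0 : (0 : ℝ) < T := by linarith
  have hs0 : (0 : ℝ) < s := by linarith
  have hm0 : (0 : ℝ) < m := by linarith
  have h1 : (m : ℝ) * ((s : ℝ) / (m * T) * T) = s := by field_simp
  have h2 : -Real.log ((s : ℝ) / T * (s / (m * T)) / 2)
      ≤ Real.log 2 + 2 * Real.log (m * T / s) := by
    have hlm := Real.log_nonneg hm'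
    rw [Real.log_div (by positivity) (by norm_num), Real.log_mul (by positivity) (by positivity),
      Real.log_div hs0.ne' hT0.ne', Real.log_div hs0.ne' (by positivity),
      Real.log_div (by positivity) hs0.ne', Real.log_mul hm0.ne' hT0.ne']
    linarith
  have h3 : -Real.log (1 - (s : ℝ) / T) ≤ 2 * ((s : ℝ) / T) := by
    have hα : (s : ℝ) / T ≤ 1 / 2 := by rw [div_le_iff₀ hT0]; linarith
    have hα0 : 0 < (s : ℝ) / T := by positivity
    have := Real.one_sub_inv_le_log_of_pos (x := 1 - (s : ℝ) / T) (by linarith)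
    have h4 : (1 - (s : ℝ) / T)⁻¹ ≤ 1 + 2 * ((s : ℝ) / T) := by
      rw [inv_eq_one_div, div_le_iff₀ (by linarith)]
      nlinarith
    linarith
  have h3' : T * (-Real.log (1 - (s : ℝ) / T)) ≤ 2 * s := by
    calc _ ≤ T * (2 * ((s : ℝ) / T)) := mul_le_mul_of_nonneg_left h3 hT0.le
      _ = 2 * s := by field_simp
  have h5 : Real.log 2 ≤ Real.log (m * T / s) := by
    refine Real.log_le_log (by norm_num) ?_
    rw [le_div_iff₀ hs0]
    nlinarith
  have h2' := mul_le_mul_of_nonneg_left h2 hs0.le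
  have h6 : (0.69 : ℝ) < Real.log 2 := by linarith [Real.log_two_gt_d9]
  have h7 : Real.log 2 < (0.7 : ℝ) := by linarith [Real.log_two_lt_d9]
  have h8 : s * (3 + Real.log 2) ≤ s * (6 * Real.log (m * T / s)) :=
    mul_le_mul_of_nonneg_left (by linarith) hs0.le
  nlinarith

/-- The step size `Λ = √(G' / T)` is optimal for the complexity `G` up to the factor `b`. -/
lemma step_size_tradeoff {G G' b T : ℝ} (hT : 0 < T) (hG' : 0 < G') (hle : G' ≤ G)
    (hb : G ≤ b * G') :
    T * Real.sqrt (G' / T) ^ 2 + 8 * G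
      ≤ Real.sqrt (G' / T) * ((1 + 8 * b) * Real.sqrt (T * G)) := by
  have hG : 0 < G := hG'.trans_le hle
  have hb0 : 0 < b := pos_of_mul_pos_left (hG.trans_le hb) hG'.le
  have h1 : T * Real.sqrt (G' / T) ^ 2 = G' := by
    rw [Real.sq_sqrt (by positivity)]
    field_simp
  have h2 : G' ≤ Real.sqrt (G' / T) * Real.sqrt (T * G) := by
    rw [← Real.sqrt_mul (by positivity)]
    refine Real.le_sqrt_of_sq_le ?_
    have : G' / T * (T * G) = G' * G := by field_simp
    rw [this, sq]
    exact mul_le_mul_of_nonneg_left hle hG'.le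
  have h3 : (1 + 8 * b) * G' ≤ (1 + 8 * b) * (Real.sqrt (G' / T) * Real.sqrt (T * G)) :=
    mul_le_mul_of_nonneg_left h2 (by positivity)
  rw [h1]
  nlinarith

/-- On a set of thick points the volume ratio `θ = (r / R) ^ (2 d)` is available as soon as
`r / R ≤ min 1 κ`. -/
lemma thickPoints_volume_le {d : ℕ} {C : Set (EuclideanSpace ℝ (Fin d))} {κ R r : ℝ} (hr : 0 < r)
    (hR : 0 < R) (hrR : r ≤ R) (hκ : r / R ≤ κ) {ρ : EuclideanSpace ℝ (Fin d)}
    (hρ : ρ ∈ GenShare.thickPoints C κ R r) :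
    (r / R) ^ (2 * d) * volume.real C ≤ volume.real (C ∩ ball ρ r) := by
  refine le_trans (mul_le_mul_of_nonneg_right ?_ measureReal_nonneg) hρ.2
  rw [pow_mul]
  have h0 : 0 < r / R := by positivity
  refine pow_le_pow_left₀ (by positivity) (le_min ?_ ?_) d
  · have : r / R ≤ 1 := (div_le_one hR).mpr hrR
    nlinarith
  · rw [mul_div_assoc, sq]
    exact mul_le_mul_of_nonneg_right hκ h0.le

/-- The regret bound against the expected utilities, for a realization of the utilities and a scale
`r` at which thick points have volume ratio `(r / R) ^ (2 d)`. -/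
theorem IsRun.offlineOpt_le {d : ℕ} {C : Set (EuclideanSpace ℝ (Fin d))} {m s T : ℕ}
    {u : ℕ → EuclideanSpace ℝ (Fin d) → ℝ} {H κ R r G' b : ℝ} {L : ℝ≥0}
    (h : IsRun C ((s : ℝ) / T) H T u) (hm : 1 ≤ m) (hs : 1 ≤ s) (hT : 2 * s ≤ T) (hH : 0 < H)
    (hr : 0 < r) (hR : 0 < R) (hrR : r ≤ R) (hκ : r / R ≤ κ) (hG' : 0 < G')
    (hle : G' ≤ m * d * Real.log (R / r) + s * Real.log (m * T / s))
    (hb : m * d * Real.log (R / r) + s * Real.log (m * T / s) ≤ b * G')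
    (hstep : Real.sqrt (G' / T) ≤ 1) :
    GenShare.offlineOpt (GenShare.thickPoints C κ R r) m s T u ≤
      (∑ t ∈ Finset.range T,
        meanUtility C (Real.sqrt (G' / T) / H) ((s : ℝ) / T) ((s : ℝ) / (m * T)) u t)
      + m * (H * GenShare.nonLipschitzCount C L T u r) + L * r * T
      + (1 + 8 * b) * (H * Real.sqrt
        (T * (m * d * Real.log (R / r) + s * Real.log (m * T / s)))) := by
  classical
  set G := m * d * Real.log (R / r) + s * Real.log (m * T / s) with hG
  set lam := Real.sqrt (G' / T) / H with hlam
  have hm' : (1 : ℝ) ≤ m := by exact_mod_cast hm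
  have hs' : (1 : ℝ) ≤ s := by exact_mod_cast hs
  have hT' : 2 * (s : ℝ) ≤ T := by exact_mod_cast hT
  have hT0 : (0 : ℝ) < T := by linarith
  have hlH : lam * H = Real.sqrt (G' / T) := div_mul_cancel₀ _ hH.ne'
  have hl : 0 < lam := by positivity
  have hb0 : 0 < b := pos_of_mul_pos_left ((hG'.trans_le hle).trans_le hb) hG'.le
  have hγ1 : (s : ℝ) / (m * T) ≤ 1 := by
    rw [div_le_one (by positivity)]
    nlinarith
  have hN := nonLipschitzCount_nonneg (C := C) (T := T) (u := u) L r
  refine Real.sSup_le (fun y hy => ?_) ?_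
  · obtain ⟨a, haD, hacard, haswitch, rfl⟩ := exists_strategy_of_mem_offlinePayoffs hs hy
    have hθ : 0 < (r / R) ^ (2 * d) := by positivity
    have hθ1 : (r / R) ^ (2 * d) ≤ 1 := pow_le_one₀ (by positivity) ((div_le_one hR).mpr hrR)
    have key := h.strategy_le (γ := (s : ℝ) / (m * T)) (L := L) hl.le hH.le (hlH ▸ hstep)
      (by positivity) hγ1 hr hθ hθ1 a (fun t _ => (haD t).1)
      (fun t _ => thickPoints_volume_le hr hR hrR hκ (haD t))
      (hacard _ fun x hx => by
        obtain ⟨t, _, rfl⟩ := Finset.mem_image.mp hx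
        exact mem_range_self t)
      (haswitch _ fun t ht => by simpa using ht)
    have hlogθ : Real.log ((r / R) ^ (2 * d)) = -(2 * d * Real.log (R / r)) := by
      rw [Real.log_pow, ← inv_div, Real.log_inv]
      push_cast
      ring
    rw [hlogθ, sub_neg_eq_add, hlH] at key
    have hcost := tracking_cost_le (d := d) (ℓ := Real.log (R / r)) hm hs hT
    have hℓ : 0 ≤ m * d * Real.log (R / r) := by
      have := Real.log_nonneg ((one_le_div hr).mpr hrR)
      positivity
    have htrade := step_size_tradeoff hT0 hG' hle hb
    rw [← hlH] at htrade key
    refine le_of_mul_le_mul_left ?_ hl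
    linarith
  · have hmean : 0 ≤ ∑ t ∈ Finset.range T,
        meanUtility C lam ((s : ℝ) / T) ((s : ℝ) / (m * T)) u t :=
      Finset.sum_nonneg fun t ht => (h.meanUtility_mem_Icc hl.le (Finset.mem_range.mp ht)).1
    positivity

/-- If the domain is so small that all of it is seen at scale `ε`, every sequence of actions has
small regret. -/
lemma IsRun.offlineOpt_le_of_diam {d : ℕ} {C : Set (EuclideanSpace ℝ (Fin d))} {m s T : ℕ}
    {u : ℕ → EuclideanSpace ℝ (Fin d) → ℝ} {α H δ ε : ℝ} {L : ℝ≥0} (h : IsRun C α H T u)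
    (hs : 1 ≤ s) (hH : 0 ≤ H) (hδ : 0 ≤ δ) (hC : ∀ x ∈ C, ∀ y ∈ C, dist x y ≤ δ) (hε : δ < ε)
    {x : ℕ → EuclideanSpace ℝ (Fin d)} (hx : ∀ t < T, x t ∈ C) :
    GenShare.offlineOpt C m s T u ≤ ∑ t ∈ Finset.range T, u t (x t)
      + H * GenShare.nonLipschitzCount C L T u ε + L * δ * T := by
  classical
  have hN := nonLipschitzCount_nonneg (C := C) (T := T) (u := u) L ε
  obtain ⟨w, hw⟩ : C.Nonempty := nonempty_of_measure_ne_zero h.volume_pos.ne'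
  have hball : ∀ y ∈ C, y ∈ ball w ε ∩ C := fun y hy => ⟨(hC y hy w hw).trans_lt hε, hy⟩
  refine Real.sSup_le (fun y hy => ?_) ?_
  · obtain ⟨a, haC, -, -, rfl⟩ := exists_strategy_of_mem_offlinePayoffs hs hy
    have := h.sum_utility_near (L := L) hH (fun _ => True) (v := a) (x := x) hw hδ
      (fun t _ _ => hball _ (haC t)) (fun t ht _ => hball _ (hx t ht))
      (fun t ht _ => hC _ (haC t) _ (hx t ht))
    simp only [if_true, Finset.sum_sub_distrib, Finset.sum_const, Finset.card_range,
      nsmul_eq_mul] at this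
    linarith
  · have : 0 ≤ ∑ t ∈ Finset.range T, u t (x t) := Finset.sum_nonneg fun t ht =>
      (h.mem_Icc t (Finset.mem_range.mp ht) _ (hx t (Finset.mem_range.mp ht))).1
    positivity

lemma IsRun.offlineOpt_le_mul {d : ℕ} {C : Set (EuclideanSpace ℝ (Fin d))} {m s T : ℕ}
    {u : ℕ → EuclideanSpace ℝ (Fin d) → ℝ} {α H : ℝ} (h : IsRun C α H T u) (hs : 1 ≤ s)
    (hH : 0 ≤ H) : GenShare.offlineOpt C m s T u ≤ H * T := by
  refine Real.sSup_le (fun y hy => ?_) (by positivity)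
  obtain ⟨a, haC, -, -, rfl⟩ := exists_strategy_of_mem_offlinePayoffs hs hy
  calc _ ≤ ∑ t ∈ Finset.range T, H := Finset.sum_le_sum fun t ht =>
        (h.mem_Icc t (Finset.mem_range.mp ht) _ (haC t)).2
    _ = H * T := by simp [mul_comm]

/-- Given the past, the action of round `t` lies in `C` and has expected utility `meanUtility`. -/
lemma integral_utility_of_isPlay {d : ℕ} {C : Set (EuclideanSpace ℝ (Fin d))} {lam α γ H : ℝ}
    {T : ℕ} {Ω : Type*} [mΩ : MeasurableSpace Ω] {P : Measure Ω} [IsProbabilityMeasure P]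
    {𝓕 : Filtration ℕ mΩ} {U : ℕ → Ω → EuclideanSpace ℝ (Fin d) → ℝ}
    {X : ℕ → Ω → EuclideanSpace ℝ (Fin d)} (hl : 0 ≤ lam)
    (hrun : ∀ ω, IsRun C α H T (fun i => U i ω))
    (hplay : GenShare.IsPlay P 𝓕 C lam α γ T U X) {t : ℕ} (ht : t < T) :
    (∀ᵐ ω ∂P, X t ω ∈ C) ∧ Integrable (fun ω => U t ω (X t ω)) P ∧
      Integrable (fun ω => meanUtility C lam α γ (fun i => U i ω) t) P ∧
      ∫ ω, U t ω (X t ω) ∂P = ∫ ω, meanUtility C lam α γ (fun i => U i ω) t ∂P := by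
  refine @integral_utility_action d C lam α γ H T Ω Ω mΩ (𝓕 t) P _ id
    (measurable_id'' (𝓕.le t)) (X t) ((hplay.action_measurable t ht).mono (𝓕.le _) le_rfl)
    U t ht hl hrun (fun i hi => ?_) (fun B hB A hA => hplay.action_law t ht B hB A hA)
  exact (hplay.utility_measurable i (hi.trans_lt ht)).mono
    (sup_le_sup (MeasurableSpace.comap_mono (𝓕.mono hi)) le_rfl) le_rfl

/-! ### The regret bound -/

theorem theorem3 (κ K B : ℝ) (hκ : 0 < κ) :
    ∃ A : ℝ, 0 < A ∧
      ∀ (d m s T : ℕ) (β R H : ℝ) (L : ℝ≥0) (C : Set (EuclideanSpace ℝ (Fin d)))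
        (c : EuclideanSpace ℝ (Fin d)) (lam : ℝ)
        (Ω : Type*) (mΩ : MeasurableSpace Ω) (P : Measure Ω) (𝓕 : Filtration ℕ mΩ)
        (U : ℕ → Ω → EuclideanSpace ℝ (Fin d) → ℝ) (X : ℕ → Ω → EuclideanSpace ℝ (Fin d)),
        IsProbabilityMeasure P →
        1 ≤ m → 1 ≤ s → 2 * s ≤ T → 0 < R → 0 < H →
        MeasurableSet C → C ⊆ closedBall c R → 0 < volume C →
        (∀ t < T, ∀ ω, ∀ ρ ∈ C, U t ω ρ ∈ Icc 0 H) →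
        (∀ t < T, ∀ ω, GenShare.PiecewiseLipschitzOn L (U t ω) C) →
        GenShare.IsDispersed P C L β K T U →
        (∀ᵐ ω ∂P,
          GenShare.offlineOpt (GenShare.thickPoints C κ R ((T : ℝ) ^ (-β))) m s T (fun t => U t ω)
            = GenShare.offlineOpt C m s T (fun t => U t ω)) →
        (lam = Real.sqrt ((m * d * Real.log (R * (T : ℝ) ^ β)
              + s * Real.log (m * T / s)) / T) / H ∨
          (lam = Real.sqrt ((m * d * Real.log (R * (T : ℝ) ^ β)
              + s * Real.log (T / s)) / T) / H ∧
            s * Real.log m ≤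
              B * (m * d * Real.log (R * (T : ℝ) ^ β) + s * Real.log (T / s)))) →
        GenShare.IsPlay P 𝓕 C lam (s / T) (s / (m * T)) T U X →
        GenShare.ExpectationLE P
          (fun ω => GenShare.sparseShiftedRegret C m s T (fun t => U t ω) (fun t => X t ω))
          (A * (H * Real.sqrt (T * (m * d * Real.log (R * (T : ℝ) ^ β)
              + s * Real.log (m * T / s)))
            + (m * H + L) * (T : ℝ) ^ (1 - β))) := by
  set M : ℝ := max 1 (1 / κ) with hM
  have hM1 : 1 ≤ M := le_max_left _ _
  set b : ℝ := 1 + max B 0 with hb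
  have hb1 : 1 ≤ b := le_add_of_nonneg_right (le_max_right _ _)
  set A : ℝ := 1 + 8 * b + |K| * (3 * M) + 2 * M with hA
  have hK0 := abs_nonneg K
  have hKM : |K| ≤ |K| * (3 * M) := le_mul_of_one_le_right hK0 (by linarith)
  have hKM0 : 0 ≤ |K| * (3 * M) := hK0.trans hKM
  refine ⟨A, by linarith, ?_⟩
  intro d m s T β R H L C c lam Ω mΩ P 𝓕 U X hP hm hs hT hR hH hCm hCR hCpos hU _ hdisp hthick hlam
    hplay
  have hm' : (1 : ℝ) ≤ m := by exact_mod_cast hm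
  have hs' : (1 : ℝ) ≤ s := by exact_mod_cast hs
  have hT' : 2 * (s : ℝ) ≤ T := by exact_mod_cast hT
  have hT0 : (0 : ℝ) < T := by linarith
  set r : ℝ := (T : ℝ) ^ (-β) with hr_def
  have hr : 0 < r := Real.rpow_pos_of_pos hT0 _
  have hRT : R * (T : ℝ) ^ β = R / r := by
    rw [hr_def, Real.rpow_neg hT0.le, div_inv_eq_mul]
  have hrT : (T : ℝ) ^ (1 - β) = r * T := by
    rw [sub_eq_add_neg, Real.rpow_add hT0, Real.rpow_one, mul_comm]
  rw [hRT] at hlam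
  rw [hRT, hrT]
  set G : ℝ := m * d * Real.log (R / r) + s * Real.log (m * T / s) with hG
  have hrun : ∀ ω, IsRun C ((s : ℝ) / T) H T (fun t => U t ω) := fun ω =>
    { measurableSet := hCm
      volume_ne_top := measure_ne_top_of_subset hCR measure_closedBall_lt_top.ne
      volume_pos := hCpos
      measurable := fun t ht => (hplay.utility_measurable t ht).comp
        (@measurable_prodMk_left _ _ (𝓕 t) _ ω)
      mem_Icc := fun t ht => hU t ht ω
      rate_pos := by positivity
      rate_lt_one := by rw [div_lt_one hT0]; linarith }
  have hl : 0 ≤ lam := by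
    rcases hlam with h | ⟨h, -⟩ <;> rw [h] <;> positivity
  have hlaw := fun t (ht : t < T) => integral_utility_of_isPlay hl hrun hplay ht
  have hXC : ∀ᵐ ω ∂P, ∀ t < T, X t ω ∈ C :=
    ae_all_iff.mpr fun t => Filter.eventually_imp_distrib_left.mpr fun ht => (hlaw t ht).1
  have hsq : 0 ≤ H * Real.sqrt (T * G) := by positivity
  have hHrT : 0 < H * (r * T) := by positivity
  have hmH : H * (r * T) ≤ m * H * (r * T) := by
    rw [mul_assoc]
    exact le_mul_of_one_le_left hHrT.le hm'
  have hLrT : 0 ≤ L * (r * T) := by positivity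
  have hdistr : A * (H * Real.sqrt (T * G) + (m * H + L) * (r * T))
      = A * (H * Real.sqrt (T * G)) + A * (m * H * (r * T)) + A * (L * (r * T)) := by ring
  rw [hdistr]
  by_cases hsmall : R ≤ M * r
  · -- `C` has diameter at most `2 M r < 3 M r`, and dispersion is available at the scale `3 M r`
    have hMr : 0 < M * r := by positivity
    have hdiam : ∀ x ∈ C, ∀ y ∈ C, dist x y ≤ 2 * (M * r) := by
      intro x hx y hy
      have h1 := mem_closedBall.mp (hCR hx)
      have h2 := mem_closedBall.mp (hCR hy)
      have h3 := dist_triangle_right x y c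
      linarith
    have hE := expectationLE_affine (W := fun _ => 0) (hdisp (3 * (M * r)) (by nlinarith))
      (integrable_const _) hH.le (L * (2 * (M * r)) * T)
    refine expectationLE_mono hE ?_ ?_
    · filter_upwards [hXC] with ω hω
      have := (hrun ω).offlineOpt_le_of_diam (m := m) (L := L) hs hH.le (by positivity) hdiam
        (ε := 3 * (M * r)) (by linarith) (x := fun t => X t ω) hω
      simp only [GenShare.sparseShiftedRegret]
      linarith
    · simp only [integral_zero, add_zero]
      have h1 : H * (K * (3 * (M * r) * T)) ≤ A * (m * H * (r * T)) := by
        calc H * (K * (3 * (M * r) * T)) = K * (3 * M) * (H * (r * T)) := by ring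
          _ ≤ |K| * (3 * M) * (H * (r * T)) := by gcongr; exact le_abs_self K
          _ ≤ A * (m * H * (r * T)) := by gcongr; linarith
      have h2 : L * (2 * (M * r)) * T ≤ A * (L * (r * T)) := by
        calc L * (2 * (M * r)) * T = 2 * M * (L * (r * T)) := by ring
          _ ≤ A * (L * (r * T)) := by gcongr; linarith
      have h3 : 0 ≤ A * (H * Real.sqrt (T * G)) := mul_nonneg (by linarith) hsq
      linarith
  · have hlarge := not_le.mp hsmall
    have hrR : r < R := (le_mul_of_one_le_left hr.le hM1).trans_lt hlarge
    have hrκ : r / R ≤ κ := by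
      have h1 : 1 / κ * r < R := (mul_le_mul_of_nonneg_right (le_max_right _ _) hr.le).trans_lt
        hlarge
      rw [div_le_iff₀ hR]
      rw [div_mul_eq_mul_div, one_mul, div_lt_iff₀ hκ] at h1
      linarith
    have hℓ : 0 ≤ m * d * Real.log (R / r) := by
      have := Real.log_nonneg ((one_le_div hr).mpr hrR.le)
      positivity
    have hs0 : (0 : ℝ) < s := by linarith
    have hTs : 0 < Real.log (T / s) := Real.log_pos (by rw [lt_div_iff₀ hs0]; linarith)
    have hlm := Real.log_nonneg hm'
    have hsplit : Real.log (m * T / s) = Real.log m + Real.log (T / s) := by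
      rw [mul_div_assoc, Real.log_mul (by positivity) (by positivity)]
    -- both step sizes are `√(G' / T) / H` for a quantity `G'` equivalent to `G`
    obtain ⟨G', hlamG, hG', hG'G, hGb⟩ : ∃ G' : ℝ, lam = Real.sqrt (G' / T) / H ∧ 0 < G' ∧
        G' ≤ G ∧ G ≤ b * G' := by
      have hsTs : 0 < s * Real.log (T / s) := mul_pos hs0 hTs
      have hslm : 0 ≤ s * Real.log m := mul_nonneg hs0.le hlm
      have hGe : G = m * d * Real.log (R / r) + s * Real.log (T / s) + s * Real.log m := by
        rw [hG, hsplit]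
        ring
      rcases hlam with h | ⟨h, hB⟩
      · exact ⟨G, h, by linarith, le_rfl, le_mul_of_one_le_left (by linarith) hb1⟩
      · refine ⟨_, h, by linarith, by linarith, ?_⟩
        have h1 := mul_le_mul_of_nonneg_right (le_max_left B 0)
          (show 0 ≤ m * d * Real.log (R / r) + s * Real.log (T / s) by linarith)
        rw [hb, add_mul, one_mul]
        linarith
    by_cases hstep : Real.sqrt (G' / T) ≤ 1
    · subst hlamG
      have hW : Integrable (fun ω => ∑ t ∈ Finset.range T,
          (meanUtility C (Real.sqrt (G' / T) / H) ((s : ℝ) / T) ((s : ℝ) / (m * T))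
            (fun i => U i ω) t - U t ω (X t ω))) P :=
        integrable_finsetSum _ fun t ht =>
          (hlaw t (Finset.mem_range.mp ht)).2.2.1.sub (hlaw t (Finset.mem_range.mp ht)).2.1
      have hW0 : ∫ ω, ∑ t ∈ Finset.range T,
          (meanUtility C (Real.sqrt (G' / T) / H) ((s : ℝ) / T) ((s : ℝ) / (m * T))
            (fun i => U i ω) t - U t ω (X t ω)) ∂P = 0 := by
        have hi : ∀ t ∈ Finset.range T, Integrable (fun ω =>
            meanUtility C (Real.sqrt (G' / T) / H) ((s : ℝ) / T) ((s : ℝ) / (m * T))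
              (fun i => U i ω) t - U t ω (X t ω)) P := fun t ht =>
          (hlaw t (Finset.mem_range.mp ht)).2.2.1.sub (hlaw t (Finset.mem_range.mp ht)).2.1
        rw [integral_finsetSum _ hi]
        refine Finset.sum_eq_zero fun t ht => ?_
        obtain ⟨-, h1, h2, h3⟩ := hlaw t (Finset.mem_range.mp ht)
        rw [integral_sub h2 h1, h3, sub_self]
      have hE := expectationLE_affine (hdisp r le_rfl) hW (k := m * H) (by positivity)
        (L * r * T + (1 + 8 * b) * (H * Real.sqrt (T * G)))
      refine expectationLE_mono hE ?_ ?_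
      · filter_upwards [hthick] with ω hω
        have := (hrun ω).offlineOpt_le (L := L) hm hs hT hH hr hR hrR.le hrκ hG' hG'G hGb hstep
        rw [hω] at this
        simp only [GenShare.sparseShiftedRegret, Finset.sum_sub_distrib]
        linarith
      · rw [hW0]
        have h1 : m * H * (K * (r * T)) ≤ A * (m * H * (r * T)) := by
          calc m * H * (K * (r * T)) = K * (m * H * (r * T)) := by ring
            _ ≤ A * (m * H * (r * T)) := by
              gcongr
              linarith [le_abs_self K]
        have h2 : L * r * T ≤ A * (L * (r * T)) := by
          rw [mul_assoc]
          exact le_mul_of_one_le_left hLrT (by linarith)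
        have h3 : (1 + 8 * b) * (H * Real.sqrt (T * G)) ≤ A * (H * Real.sqrt (T * G)) := by
          gcongr
          linarith
        linarith
    · -- here `T < G' ≤ G`, and the bound exceeds the total payoff `H T`
      have hTG : T ≤ G := by
        have h1 := (Real.lt_sqrt zero_le_one).mp (not_le.mp hstep)
        rw [one_pow, lt_div_iff₀ hT0, one_mul] at h1
        linarith
      have hTsq : (T : ℝ) ≤ Real.sqrt (T * G) := by
        refine Real.le_sqrt_of_sq_le ?_
        rw [sq]
        exact mul_le_mul_of_nonneg_left hTG hT0.le
      refine ⟨fun _ => H * T, integrable_const _, ?_, ?_⟩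
      · filter_upwards [hXC] with ω hω
        have h1 := (hrun ω).offlineOpt_le_mul (m := m) hs hH.le
        have h2 : 0 ≤ ∑ t ∈ Finset.range T, U t ω (X t ω) := Finset.sum_nonneg fun t ht =>
          (hU t (Finset.mem_range.mp ht) ω _ (hω t (Finset.mem_range.mp ht))).1
        simp only [GenShare.sparseShiftedRegret]
        linarith
      · have h1 : H * T ≤ A * (H * Real.sqrt (T * G)) := by
          calc H * T ≤ H * Real.sqrt (T * G) := by gcongr
            _ ≤ _ := le_mul_of_one_le_left hsq (by linarith)
        have h2 : 0 ≤ A * (m * H * (r * T)) := mul_nonneg (by linarith) (hHrT.le.trans hmH)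
        have h3 : 0 ≤ A * (L * (r * T)) := mul_nonneg (by linarith) hLrT
        simp only [integral_const, probReal_univ, one_smul]
        linarith
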